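/- Let clocks take values in $\mathbb{N}$ (discrete time) and parameters take values in $\mathbb{Z}$. A linear expression is $c_0+c_1p_1+\cdots+c_np_n$ with $c_i\in\mathbb{Z}$ and parameters $p_i$, or $\infty$; it is parametric if some parameter has a nonzero coefficient in it. An atomic constraint is $x\prec e$, $-x\prec e$ or $x-y\prec e$ with clocks $x,y$, a linear expression $e$ and $\prec\,\in\{<,\le,=\}$; a simple constraint is a finite conjunction of atomic constraints. A parametric timed automaton (PTA) $\mathcal{A}$ consists of a finite set of actions, a finite set of locations with an initial location, a simple constraint $I_q$ (the invariant) for each location $q$, and finitely many transitions $(q,g,a,u,q')$, where $g$ is a simple constraint, $a$ an action and $u$ a finite set of resets $x:=b$ with $b\in\mathbb{N}$, at most one for each clock. For a parameter valuation $\gamma$, the states of $\mathcal{A}[\gamma]$ are the pairs $(q,\omega)$ of a location and a clock valuation with $(\gamma,\omega)\models I_q$; the initial state is the initial location with all clocks $0$, provided that this is a state; the steps between states are $(q,\omega)\to(q',\omega[u])$ for transitions $(q,g,a,u,q')$ with $(\gamma,\omega)\models g$, and $(q,\omega)\to(q,\omega+d)$ for $d\in\mathbb{N}$. A state property $\phi$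 is a Boolean combination of atomic constraints and locations, and $\mathcal{A}[\gamma]\models\forall\Box\phi$ means that $\phi$ holds in all states that are reachable in $\mathcal{A}[\gamma]$ from an initial state. Put $\Gamma(\mathcal{A},\forall\Box\phi)=\{\gamma\mid \mathcal{A}[\gamma]\models\forall\Box\phi\}$. **Statement.** There is an algorithm which, given a PTA $\mathcal{A}$ and a state property $\phi$ such that at most one clock occurs in the constraints of $\mathcal{A}$ and $\phi$ with a parametric expression (the number of other clocks and the number of parameters being arbitrary), computes the set $\Gamma(\mathcal{A},\forall\Box\phi)$: it outputs a finite list of finite systems, each consisting of linear inequalities $e\ge 0$, linear equations $e=0$ and linear congruences $e\equiv 0 \pmod k$ in the parameters, with integer coefficients, such that $\Gamma(\mathcal{A},\forall\Box\phi)$ is the union of the sets of integer solutions of these systems. -/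

import Mathlib

namespace ParamTA

/-! Clocks, parameters, actions and locations are named by natural numbers.  Time is discrete:
clock values are natural numbers, and parameters take integer values. -/

/-- A clock valuation. -/
abbrev ClockVal := ℕ → ℕ

/-- A parameter valuation. -/
abbrev ParamVal := ℕ → ℤ

/-- A (finite) linear expression `c₀ + c₁ p₁ + ⋯ + cₙ pₙ` with integer coefficients; the entry
`(p, c)` of `terms` stands for the summand `c * p`. -/
structure LinExpr where
  const : ℤ
  terms : List (ℕ × ℤ)

/-- The coefficient of the parameter `p`. -/
def LinExpr.cf (e : LinExpr) (p : ℕ) : ℤ :=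
  ((e.terms.filter (fun t => t.1 = p)).map Prod.snd).sum

/-- The value of a linear expression under a parameter valuation. -/
def LinExpr.eval (e : LinExpr) (γ : ParamVal) : ℤ :=
  e.const + (e.terms.map (fun t => t.2 * γ t.1)).sum

/-- An expression: a linear expression or `∞`. -/
inductive Expression where
  | lin (e : LinExpr)
  | infty

def Expression.eval : Expression → ParamVal → WithTop ℤ
  | .lin e, γ => (e.eval γ : ℤ)
  | .infty, _ => ⊤

/-- An expression is parametric if some parameter really occurs in it. -/
def Expression.IsParametric : Expression → Prop
  | .lin e => ∃ p, e.cf p ≠ 0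
  | .infty => False

/-- The left-hand sides `x`, `-x` and `x - y` of constraints. -/
inductive ClockTerm where
  | pos (x : ℕ)
  | neg (x : ℕ)
  | diff (x y : ℕ)

def ClockTerm.eval : ClockTerm → ClockVal → ℤ
  | .pos x, ω => (ω x : ℤ)
  | .neg x, ω => -(ω x : ℤ)
  | .diff x y, ω => (ω x : ℤ) - (ω y : ℤ)

/-- The clock `z` occurs in the term. -/
def ClockTerm.Mentions : ClockTerm → ℕ → Prop
  | .pos x, z => z = x
  | .neg x, z => z = x
  | .diff x y, z => z = x ∨ z = y

inductive Comparison where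
  | lt
  | le
  | eq

def Comparison.Holds : Comparison → WithTop ℤ → WithTop ℤ → Prop
  | .lt, a, b => a < b
  | .le, a, b => a ≤ b
  | .eq, a, b => a = b

/-- An atomic constraint `x ≺ e`, `-x ≺ e` or `x - y ≺ e` with `≺` one of `<`, `≤`, `=`. -/
structure AtomicConstraint where
  lhs : ClockTerm
  cmp : Comparison
  rhs : Expression

/-- `(γ, ω) ⊨ c`. -/
def AtomicConstraint.Holds (c : AtomicConstraint) (γ : ParamVal) (ω : ClockVal) : Prop :=
  c.cmp.Holds ((c.lhs.eval ω : ℤ) : WithTop ℤ) (c.rhs.eval γ)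

/-- A simple constraint: the conjunction of finitely many atomic constraints. -/
abbrev SimpleConstraint := List AtomicConstraint

def SimpleConstraint.Holds (g : SimpleConstraint) (γ : ParamVal) (ω : ClockVal) : Prop :=
  ∀ c ∈ g, c.Holds γ ω

/-- An update set; the entry `(x, b)` is the reset `x := b`. -/
abbrev UpdateSet := List (ℕ × ℕ)

/-- The valuation `ω[u]`. -/
def applyUpdate (ω : ClockVal) (u : UpdateSet) : ClockVal :=
  fun x => (u.lookup x).getD (ω x)

/-- A transition `(src, guard, act, upd, tgt)`. -/
structure Edge where
  src : ℕ
  guard : SimpleConstraint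
  act : ℕ
  upd : UpdateSet
  tgt : ℕ

/-- A parametric timed automaton as a finite object.  If `inv` has length `k`, then the locations
are `0, …, k - 1`, and the invariant of location `q` is the entry number `q` of `inv`. -/
structure PTA where
  actions : List ℕ
  inv : List SimpleConstraint
  init : ℕ
  edges : List Edge

/-- The initial location and the ends of the transitions are locations, the transitions are
labelled by actions of the automaton, and an update set has at most one reset for each clock. -/
def PTA.WellFormed (A : PTA) : Prop :=
  A.init < A.inv.length ∧
    ∀ t ∈ A.edges, t.src < A.inv.length ∧ t.tgt < A.inv.length ∧ t.act ∈ A.actions ∧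
      (t.upd.map Prod.fst).Nodup

/-- The atomic constraints that occur in the invariants and guards of `A`. -/
def PTA.HasConstraint (A : PTA) (c : AtomicConstraint) : Prop :=
  (∃ g ∈ A.inv, c ∈ g) ∨ ∃ t ∈ A.edges, c ∈ t.guard

/-- A labelled transition system with states in the set `states`. -/
structure LTS (σ δ : Type) where
  states : Set σ
  init : Set σ
  step : σ → δ → σ → Prop

/-- `s` is the last state of a finite run. -/
def LTS.Reachable {σ δ : Type} (L : LTS σ δ) (s : σ) : Prop :=
  ∃ s₀ ∈ L.init, Relation.ReflTransGen (fun s₁ s₂ => ∃ a, L.step s₁ a s₂) s₀ s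

/-- The states of the concrete semantics: a location and a clock valuation that, together with
`γ`, satisfies the invariant of the location. -/
def PTA.stateSet (A : PTA) (γ : ParamVal) : Set (ℕ × ClockVal) :=
  {s | ∃ g, A.inv[s.1]? = some g ∧ SimpleConstraint.Holds g γ s.2}

/-- The concrete semantics `A[γ]`.  A label is an action (`Sum.inl a`) or a delay (`Sum.inr d`). -/
def PTA.semantics (A : PTA) (γ : ParamVal) : LTS (ℕ × ClockVal) (ℕ ⊕ ℕ) where
  states := A.stateSet γ
  init := {s | s ∈ A.stateSet γ ∧ s = (A.init, fun _ => 0)}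
  step := fun s l s' => s ∈ A.stateSet γ ∧ s' ∈ A.stateSet γ ∧
    match l with
    | Sum.inl a => ∃ t ∈ A.edges, t.src = s.1 ∧ t.act = a ∧ t.tgt = s'.1 ∧
        SimpleConstraint.Holds t.guard γ s.2 ∧ s'.2 = applyUpdate s.2 t.upd
    | Sum.inr d => s'.1 = s.1 ∧ s'.2 = fun x => s.2 x + d

/-- State properties. -/
inductive StateProp where
  | atom (c : AtomicConstraint)
  | loc (q : ℕ)
  | not (φ : StateProp)
  | and (φ₁ φ₂ : StateProp)
  | or (φ₁ φ₂ : StateProp)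

def StateProp.Holds (γ : ParamVal) (s : ℕ × ClockVal) : StateProp → Prop
  | .atom c => c.Holds γ s.2
  | .loc q => s.1 = q
  | .not φ => ¬ φ.Holds γ s
  | .and φ₁ φ₂ => φ₁.Holds γ s ∧ φ₂.Holds γ s
  | .or φ₁ φ₂ => φ₁.Holds γ s ∨ φ₂.Holds γ s

/-- The atomic constraint `c` occurs in the state property. -/
def StateProp.HasConstraint (c : AtomicConstraint) : StateProp → Prop
  | .atom c' => c = c'
  | .loc _ => False
  | .not φ => φ.HasConstraint c
  | .and φ₁ φ₂ => φ₁.HasConstraint c ∨ φ₂.HasConstraint c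
  | .or φ₁ φ₂ => φ₁.HasConstraint c ∨ φ₂.HasConstraint c

/-- System properties `∀□φ` and `∃◇φ`. -/
inductive SystemProp where
  | always (φ : StateProp)
  | possibly (φ : StateProp)

/-- `A[γ] ⊨ ψ`. -/
def PTA.Satisfies (A : PTA) (γ : ParamVal) : SystemProp → Prop
  | .always φ => ∀ s, (A.semantics γ).Reachable s → φ.Holds γ s
  | .possibly φ => ∃ s, (A.semantics γ).Reachable s ∧ φ.Holds γ s

/-- The feasible region `Γ(A, ψ)`. -/
def PTA.feasible (A : PTA) (ψ : SystemProp) : Set ParamVal :=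
  {γ | A.Satisfies γ ψ}

/-- The clock `x` occurs in a parametric constraint of `A` or of `φ`. -/
def IsParametricClock (A : PTA) (φ : StateProp) (x : ℕ) : Prop :=
  ∃ c : AtomicConstraint, (A.HasConstraint c ∨ φ.HasConstraint c) ∧
    c.rhs.IsParametric ∧ c.lhs.Mentions x

/-- At most one clock is parametrically constrained; there may be any number of other clocks. -/
def OneParametricClock (A : PTA) (φ : StateProp) : Prop :=
  ∃ x, ∀ y, IsParametricClock A φ y → y = x

/-- The basic conditions on parameters in the output of the synthesis: a linear inequality
`e ≥ 0`, a linear equation `e = 0`, or a linear congruence `e ≡ 0 (mod k)`. -/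
inductive ParamCondition where
  | nonneg (e : LinExpr)
  | zero (e : LinExpr)
  | cong (k : ℕ) (e : LinExpr)

def ParamCondition.Holds (γ : ParamVal) : ParamCondition → Prop
  | .nonneg e => 0 ≤ e.eval γ
  | .zero e => e.eval γ = 0
  | .cong k e => (k : ℤ) ∣ e.eval γ

/-- A finite system of conditions, read as a conjunction. -/
abbrev ParamSystem := List ParamCondition

/-- The union of the solution sets of finitely many systems. -/
def solutionSet (D : List ParamSystem) : Set ParamVal :=
  {γ | ∃ S ∈ D, ∀ c ∈ S, c.Holds γ}

/-! Gödel numberings: all the above finite objects are coded by natural numbers through the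
standard codings of pairs, lists and disjoint sums, so that `Computable` makes sense for functions
between them. -/

def LinExpr.equiv : LinExpr ≃ ℤ × List (ℕ × ℤ) where
  toFun e := (e.const, e.terms)
  invFun t := ⟨t.1, t.2⟩
  left_inv _ := rfl
  right_inv _ := rfl

instance : Denumerable LinExpr := Denumerable.ofEquiv _ LinExpr.equiv

def Expression.equiv : Expression ≃ Option LinExpr where
  toFun
    | .lin e => some e
    | .infty => none
  invFun
    | some e => .lin e
    | none => .infty
  left_inv e := by cases e <;> rfl
  right_inv e := by cases e <;> rfl

instance : Denumerable Expression := Denumerable.ofEquiv _ Expression.equiv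

def ClockTerm.equiv : ClockTerm ≃ (ℕ ⊕ ℕ) ⊕ (ℕ × ℕ) where
  toFun
    | .pos x => .inl (.inl x)
    | .neg x => .inl (.inr x)
    | .diff x y => .inr (x, y)
  invFun
    | .inl (.inl x) => .pos x
    | .inl (.inr x) => .neg x
    | .inr (x, y) => .diff x y
  left_inv e := by cases e <;> rfl
  right_inv e := by rcases e with (e | e) | e <;> rfl

instance : Denumerable ClockTerm := Denumerable.ofEquiv _ ClockTerm.equiv

def AtomicConstraint.equiv : AtomicConstraint ≃
    ((ClockTerm × Expression) ⊕ (ClockTerm × Expression)) ⊕ (ClockTerm × Expression) where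
  toFun
    | ⟨l, .lt, r⟩ => .inl (.inl (l, r))
    | ⟨l, .le, r⟩ => .inl (.inr (l, r))
    | ⟨l, .eq, r⟩ => .inr (l, r)
  invFun
    | .inl (.inl (l, r)) => ⟨l, .lt, r⟩
    | .inl (.inr (l, r)) => ⟨l, .le, r⟩
    | .inr (l, r) => ⟨l, .eq, r⟩
  left_inv e := by rcases e with ⟨l, _ | _ | _, r⟩ <;> rfl
  right_inv e := by rcases e with (e | e) | e <;> rfl

instance : Denumerable AtomicConstraint := Denumerable.ofEquiv _ AtomicConstraint.equiv

def Edge.equiv : Edge ≃ ℕ × SimpleConstraint × ℕ × UpdateSet × ℕ where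
  toFun t := (t.src, t.guard, t.act, t.upd, t.tgt)
  invFun t := ⟨t.1, t.2.1, t.2.2.1, t.2.2.2.1, t.2.2.2.2⟩
  left_inv _ := rfl
  right_inv _ := rfl

instance : Denumerable Edge := Denumerable.ofEquiv _ Edge.equiv

def PTA.equiv : PTA ≃ List ℕ × List SimpleConstraint × ℕ × List Edge where
  toFun A := (A.actions, A.inv, A.init, A.edges)
  invFun t := ⟨t.1, t.2.1, t.2.2.1, t.2.2.2⟩
  left_inv _ := rfl
  right_inv _ := rfl

instance : Denumerable PTA := Denumerable.ofEquiv _ PTA.equiv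

def ParamCondition.equiv : ParamCondition ≃ (LinExpr ⊕ LinExpr) ⊕ (ℕ × LinExpr) where
  toFun
    | .nonneg e => .inl (.inl e)
    | .zero e => .inl (.inr e)
    | .cong k e => .inr (k, e)
  invFun
    | .inl (.inl e) => .nonneg e
    | .inl (.inr e) => .zero e
    | .inr (k, e) => .cong k e
  left_inv e := by cases e <;> rfl
  right_inv e := by rcases e with (e | e) | e <;> rfl

instance : Denumerable ParamCondition := Denumerable.ofEquiv _ ParamCondition.equiv

/-- The code of a state property, by recursion on its structure. -/
def StateProp.toNat : StateProp → ℕ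
  | .atom c => 5 * Encodable.encode c
  | .loc q => 5 * q + 1
  | .not φ => 5 * φ.toNat + 2
  | .and φ₁ φ₂ => 5 * Nat.pair φ₁.toNat φ₂.toNat + 3
  | .or φ₁ φ₂ => 5 * Nat.pair φ₁.toNat φ₂.toNat + 4

theorem StateProp.toNat_injective : Function.Injective StateProp.toNat := by
  intro φ
  induction φ with
  | atom c =>
    intro χ h
    cases χ <;> simp only [StateProp.toNat] at h <;> first | omega | skip
    congr 1
    exact Encodable.encode_injective (by omega)
  | loc q =>
    intro χ h
    cases χ <;> simp only [StateProp.toNat] at h <;> first | omega | skip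
    congr 1
    omega
  | not φ ih =>
    intro χ h
    cases χ <;> simp only [StateProp.toNat] at h <;> first | omega | skip
    congr 1
    exact ih (by omega)
  | and φ₁ φ₂ ih₁ ih₂ =>
    intro χ h
    cases χ <;> simp only [StateProp.toNat] at h <;> first | omega | skip
    have h' := Nat.pair_eq_pair.1 (Nat.eq_of_mul_eq_mul_left (by norm_num : 0 < 5)
      (Nat.add_right_cancel h))
    rw [ih₁ h'.1, ih₂ h'.2]
  | or φ₁ φ₂ ih₁ ih₂ =>
    intro χ h
    cases χ <;> simp only [StateProp.toNat] at h <;> first | omega | skip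
    have h' := Nat.pair_eq_pair.1 (Nat.eq_of_mul_eq_mul_left (by norm_num : 0 < 5)
      (Nat.add_right_cancel h))
    rw [ih₁ h'.1, ih₂ h'.2]

/-- The state property with a given code. -/
def StateProp.ofNat (n : ℕ) : StateProp :=
  if _h0 : n % 5 = 0 then .atom (Denumerable.ofNat AtomicConstraint (n / 5))
  else if _h1 : n % 5 = 1 then .loc (n / 5)
  else if _h2 : n % 5 = 2 then .not (StateProp.ofNat (n / 5))
  else if _h3 : n % 5 = 3 then
    .and (StateProp.ofNat (Nat.unpair (n / 5)).1) (StateProp.ofNat (Nat.unpair (n / 5)).2)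
  else .or (StateProp.ofNat (Nat.unpair (n / 5)).1) (StateProp.ofNat (Nat.unpair (n / 5)).2)
termination_by n
decreasing_by
  all_goals
    have h1 := Nat.unpair_left_le (n / 5)
    have h2 := Nat.unpair_right_le (n / 5)
    omega

theorem StateProp.toNat_ofNat (n : ℕ) : (StateProp.ofNat n).toNat = n := by
  induction n using Nat.strong_induction_on with
  | _ n ih =>
    have hl := Nat.unpair_left_le (n / 5)
    have hr := Nat.unpair_right_le (n / 5)
    rw [StateProp.ofNat]
    split_ifs with h0 h1 h2 h3
    · simp only [StateProp.toNat, Denumerable.encode_ofNat]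
      omega
    · simp only [StateProp.toNat]
      omega
    · simp only [StateProp.toNat]
      rw [ih _ (by omega)]
      omega
    · simp only [StateProp.toNat]
      rw [ih _ (by omega), ih _ (by omega), Nat.pair_unpair]
      omega
    · simp only [StateProp.toNat]
      rw [ih _ (by omega), ih _ (by omega), Nat.pair_unpair]
      omega

def StateProp.equiv : StateProp ≃ ℕ where
  toFun := StateProp.toNat
  invFun := StateProp.ofNat
  left_inv φ := StateProp.toNat_injective (StateProp.toNat_ofNat φ.toNat)
  right_inv := StateProp.toNat_ofNat

instance : Denumerable StateProp := Denumerable.ofEquiv _ StateProp.equiv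

end ParamTA

namespace ParamTA

/-! Let `K` bound all data of `A` and `φ`. Parameters matter only through the values of finitely
many linear expressions, so a parameter valuation is replaced by the sequence `v` of values of the
expressions with codes below `K`. A parametric constraint mentions no clock but the one parametric
clock `x`. Which parametric constraints hold is therefore a function of the value `t` of `x`, the
letter at `t`, and it can change only where `t` passes some `|v i|`. The other constraints compare
clocks with constants, so for them clock values and differences may be truncated. What remains is a
system with finitely many control states and one counter `x`, which is incremented or set to a
constant and sees only the current letter (`unsafe_iff_absReach`).

While the letter is constant, the set of control states after each tick evolves by iterating one map
on a finite power set. The iterates are eventually periodic with uniform bounds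
(`iterate_add_factorial`), so changing a long gap between consecutive values `|v i|` by the period
cannot be noticed (`CReach.shift`, `Unsafe.shift`). Shrinking gaps as long as possible leads to a
reduced valuation (`exists_reduced`). Each shrinking preserves similarity, that is, truncated
entries, sums and differences together with residues, and similar reduced valuations coincide
(`SimilarVal.eq_of_reduced`). Hence safety depends only on the similarity class
(`unsafe_iff_of_similar`).

Reduced valuations lie in an explicit finite box (`Reduced.abs_lt`), and similarity to a fixed list
is a system of linear inequalities, equations and congruences (`similarSystem_holds`). The algorithm
runs through the box, decides safety of each list by a search of bounded depth
(`unsafe_iff_search`), and outputs the systems of the safe lists. Every ingredient is primitive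
recursive. -/

/-! ### Orbits of self-maps of finite types -/

open Function in
/-- On a finite type, the orbits of a self-map are eventually periodic, with uniform bounds. -/
theorem iterate_add_factorial {X : Type*} [Fintype X] (f : X → X) {C : ℕ}
    (hC : Fintype.card X ≤ C) (x : X) {n : ℕ} (hn : C ≤ n) :
    f^[n + C.factorial] x = f^[n] x := by
  obtain ⟨i, j, hij, heq⟩ := Fintype.exists_ne_map_eq_of_card_lt
    (fun i : Fin (C + 1) => f^[i] x) (by simpa using Nat.lt_succ_of_le hC)
  wlog hlt : i < j generalizing i j
  · exact this j i hij.symm heq.symm (lt_of_le_of_ne (not_lt.1 hlt) hij.symm)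
  have hlt' : (i : ℕ) < j := hlt
  have hper : IsPeriodicPt f (j - i) (f^[i] x) := by
    rw [IsPeriodicPt, IsFixedPt, ← iterate_add_apply, Nat.sub_add_cancel hlt'.le]
    exact heq.symm
  have hdvd : ((j : ℕ) - i) ∣ C.factorial := Nat.dvd_factorial (by omega) (by omega)
  have e1 : f^[n + C.factorial] x = f^[C.factorial] (f^[n - i] (f^[i] x)) := by
    rw [← iterate_add_apply, ← iterate_add_apply]
    congr 1
    omega
  have e2 : f^[n] x = f^[n - i] (f^[i] x) := by
    rw [← iterate_add_apply]
    congr 1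
    omega
  rw [e1, e2]
  exact (hper.trans_dvd hdvd).apply_iterate (n - i)

/-- Inflationary monotone self-maps of a power set are stationary after `2 ^ card` steps. -/
theorem iterate_subset_of_inflationary {S : Type*} [Fintype S] (f : Set S → Set S)
    (hf : ∀ U, U ⊆ f U) {C : ℕ} (hC : 2 ^ Fintype.card S ≤ C) (U : Set S) (n : ℕ) :
    f^[n] U ⊆ f^[C] U := by
  classical
  have hmono : ∀ i j, i ≤ j → f^[i] U ⊆ f^[j] U := by
    intro i j hij
    induction j, hij using Nat.le_induction with
    | base => exact subset_rfl
    | succ j _ ih =>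
      rw [Function.iterate_succ_apply']
      exact ih.trans (hf _)
  have hper : ∀ m, f^[C + m * C.factorial] U = f^[C] U := by
    intro m
    induction m with
    | zero => simp
    | succ m ih =>
      rw [Nat.succ_mul, ← Nat.add_assoc,
        iterate_add_factorial f (by simpa using hC) U (by omega), ih]
  -- The iterates increase and return to the same set after every `C!` further steps; after `n` such
  -- periods the index exceeds `n`.
  rw [← hper n]
  refine hmono _ _ ?_
  have := Nat.factorial_pos C
  nlinarith

/-! ### Counter systems that read a letter at each counter value -/

section Counter

variable {S Λ : Type*} (I : Λ → S → Prop) (J : Λ → S → S → Prop) (D : Λ → Λ → S → S → Prop)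
  (Z : Λ → Λ → ℕ → S → S → Prop)

/-- Reachability in a counter system with control states `S`: at counter value `t` the letter
`a t` is visible; a jump keeps the counter, a tick increments it, and a reset assigns a constant. -/
inductive CReach (a : ℕ → Λ) : S → ℕ → Prop
  | init {s} : I (a 0) s → CReach a s 0
  | jump {s s' t} : CReach a s t → J (a t) s s' → CReach a s' t
  | tick {s s' t} : CReach a s t → D (a t) (a (t + 1)) s s' → CReach a s' (t + 1)
  | reset {s s' t b} : CReach a s t → Z (a t) (a b) b s s' → CReach a s' b

/-- The states reachable from `U` by one tick followed by jumps, while the letter is `l`. -/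
def tickImage (l : Λ) (U : Set S) : Set S :=
  {s' | ∃ s ∈ U, ∃ m, D l l s m ∧ Relation.ReflTransGen (J l) m s'}

variable {I J D Z}

theorem CReach.jumps {a : ℕ → Λ} {s s' : S} {t : ℕ} (h : CReach I J D Z a s t)
    (hs : Relation.ReflTransGen (J (a t)) s s') : CReach I J D Z a s' t := by
  induction hs with
  | refl => exact h
  | tail _ h2 ih => exact ih.jump h2

theorem CReach.of_mem_iterate {a : ℕ → Λ} {p g : ℕ} (hc : ∀ j ≤ g, a (p + j) = a p) {j : ℕ}
    (hj : j ≤ g) : ∀ {s : S}, s ∈ (tickImage J D (a p))^[j] {s | CReach I J D Z a s p} →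
      CReach I J D Z a s (p + j) := by
  induction j with
  | zero => intro s hs; exact hs
  | succ j ih =>
    intro s hs
    rw [Function.iterate_succ_apply'] at hs
    obtain ⟨s1, h1, m, hm, hms⟩ := hs
    have h2 := ih (by omega) h1
    have e1 := hc j (by omega)
    have e2 := hc (j + 1) hj
    have e2' : a (p + j + 1) = a p := e2
    have h3 : CReach I J D Z a m (p + j + 1) := CReach.tick h2 (by rwa [e1, e2'])
    exact h3.jumps (by rwa [e2'])

/-- Changing the length of a long interval with constant letter does not affect reachability. -/
theorem CReach.shift {a a' : ℕ → Λ} {p g g' : ℕ}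
    (hZ : ∀ l l' b s s', Z l l' b s s' → b ≤ p)
    (h0 : ∀ t ≤ p, a t = a' t) (hc : ∀ j ≤ g, a (p + j) = a p) (hc' : ∀ j ≤ g', a' (p + j) = a' p)
    (hshift : ∀ i, a (p + g + i) = a' (p + g' + i))
    (hT : ∀ U j, j ≤ g → ∃ j' ≤ g', (tickImage J D (a p))^[j] U = (tickImage J D (a p))^[j'] U)
    (hT' : ∀ U, (tickImage J D (a p))^[g] U = (tickImage J D (a p))^[g'] U)
    {s : S} {t : ℕ} (h : CReach I J D Z a s t) :
    ∃ t', a t = a' t' ∧ CReach I J D Z a' s t' := by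
  have hp : a p = a' p := h0 p le_rfl
  have mem : ∀ {s j}, j ≤ g' → s ∈ (tickImage J D (a p))^[j] {s | CReach I J D Z a' s p} →
      CReach I J D Z a' s (p + j) := by
    intro s j hj hs
    rw [hp] at hs
    exact CReach.of_mem_iterate hc' hj hs
  have low : ∀ {s t}, t ≤ p → CReach I J D Z a' s t →
    (t ≤ p → CReach I J D Z a' s t) ∧
    (∀ j ≤ g, t = p + j → s ∈ (tickImage J D (a p))^[j] {s | CReach I J D Z a' s p}) ∧
    (∀ i, t = p + g + i → CReach I J D Z a' s (p + g' + i)) := by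
    intro s t ht hs
    refine ⟨fun _ => hs, ?_, ?_⟩
    · intro j _ htj
      obtain rfl : j = 0 := by omega
      obtain rfl : t = p := by omega
      exact hs
    · intro i hti
      obtain rfl : g = 0 := by omega
      obtain rfl : i = 0 := by omega
      obtain rfl : t = p := by omega
      refine mem le_rfl ?_
      rw [← hT']
      exact hs
  have mid : ∀ {s t}, (∀ j ≤ g, t = p + j →
        s ∈ (tickImage J D (a p))^[j] {s | CReach I J D Z a' s p}) → t = p + g →
        CReach I J D Z a' s (p + g') := by
    intro s t hs ht
    have := hs g le_rfl ht
    rw [hT'] at this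
    exact mem le_rfl this
  -- A reset may start anywhere inside the interval. To replay it, some position of `a'` with the
  -- same state and the same letter is enough, and `hT` provides one.
  have loc : ∀ {s t}, ((t ≤ p → CReach I J D Z a' s t) ∧
    (∀ j ≤ g, t = p + j → s ∈ (tickImage J D (a p))^[j] {s | CReach I J D Z a' s p}) ∧
    (∀ i, t = p + g + i → CReach I J D Z a' s (p + g' + i))) →
    ∃ t', a t = a' t' ∧ CReach I J D Z a' s t' := by
    rintro s t ⟨h1, h2, h3⟩
    rcases le_total t p with ht | ht
    · exact ⟨t, h0 t ht, h1 ht⟩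
    obtain ⟨j, rfl⟩ := Nat.exists_eq_add_of_le ht
    rcases le_total j g with hj | hj
    · obtain ⟨j', hj', he⟩ := hT {s | CReach I J D Z a' s p} j hj
      have := h2 j hj rfl
      rw [he] at this
      exact ⟨p + j', by rw [hc j hj, hc' j' hj', hp], mem hj' this⟩
    · obtain ⟨i, rfl⟩ := Nat.exists_eq_add_of_le hj
      exact ⟨p + g' + i, by rw [← hshift, add_assoc], h3 i (by omega)⟩
  -- Inside the interval positions of the two systems need not correspond. What is carried along is
  -- membership in an iterated image of all states that are `a'`-reachable at `p`. This set already
  -- accounts for repeated visits, because resets land at or below `p`. The three ranges overlap at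
  -- `p` and `p + g`, where `low` and `mid` pass from one form to the next.
  have key : ∀ {s t}, CReach I J D Z a s t →
      (t ≤ p → CReach I J D Z a' s t) ∧
      (∀ j ≤ g, t = p + j → s ∈ (tickImage J D (a p))^[j] {s | CReach I J D Z a' s p}) ∧
      (∀ i, t = p + g + i → CReach I J D Z a' s (p + g' + i)) := by
    intro s t h
    induction h with
    | init hi => exact low (Nat.zero_le _) (CReach.init (by rwa [← h0 0 (Nat.zero_le _)]))
    | @jump s s' t _ hj ih =>
      obtain ⟨h1, h2, h3⟩ := ih
      refine ⟨fun ht => (h1 ht).jump (by rwa [← h0 t ht]), ?_, ?_⟩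
      · rintro j hjg rfl
        have := h2 j hjg rfl
        rw [hc j hjg] at hj
        cases j with
        | zero =>
          rw [hp] at hj
          exact CReach.jump this hj
        | succ j =>
          rw [Function.iterate_succ_apply'] at this ⊢
          obtain ⟨s1, hs1, m, hm, hms⟩ := this
          exact ⟨s1, hs1, m, hm, hms.tail hj⟩
      · rintro i rfl
        exact (h3 i rfl).jump (by rwa [← hshift])
    | @tick s s' t _ hd ih =>
      have h1 := ih.1
      have h2 := ih.2.1
      have h3 := ih.2.2
      rcases Nat.lt_or_ge t p with ht | ht
      · refine low ht (CReach.tick (h1 ht.le) ?_)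
        rwa [← h0 t ht.le, ← h0 (t + 1) ht]
      obtain ⟨j, rfl⟩ := Nat.exists_eq_add_of_le ht
      have h2' : ∀ j' ≤ g, p + j + 1 = p + j' →
          s' ∈ (tickImage J D (a p))^[j'] {s | CReach I J D Z a' s p} := by
        intro j' hj' he
        obtain rfl : j' = j + 1 := by omega
        rw [Function.iterate_succ_apply']
        refine ⟨s, h2 j (by omega) rfl, s', ?_, .refl⟩
        rwa [add_assoc, hc j (by omega), hc (j + 1) hj'] at hd
      refine ⟨fun h => absurd h (by omega), h2', ?_⟩
      intro i hi
      cases i with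
      | zero => exact mid h2' hi
      | succ i =>
        obtain rfl : j = g + i := by omega
        have := CReach.tick (s' := s') (h3 i (by omega))
          (by rw [← hshift, add_assoc (p + g'), ← hshift]; rwa [add_assoc, add_assoc] at *)
        rwa [add_assoc] at this
    | @reset s s' t b _ hz ih =>
      have hb := hZ _ _ _ _ _ hz
      obtain ⟨t', hta, hr⟩ := loc ih
      exact low hb (CReach.reset hr (by rwa [← hta, ← h0 b hb]))
  exact loc (key h)

end Counter

/-! ### Similarity of integer sequences and reduced representatives -/

/-- `a` and `b` agree after truncation to the interval `[-N, N]`. -/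
def ClampEq (N a b : ℤ) : Prop := a = b ∨ (N ≤ a ∧ N ≤ b) ∨ (a ≤ -N ∧ b ≤ -N)

/-- The first `K` entries of `v` and `w` cannot be told apart by comparing entries, sums and
differences of entries with constants in `[-N, N]`, nor by residues modulo `k`. -/
structure SimilarVal (K : ℕ) (N k : ℤ) (v w : ℕ → ℤ) : Prop where
  self : ∀ i < K, ClampEq N (v i) (w i)
  sub : ∀ i < K, ∀ j < K, ClampEq N (v i - v j) (w i - w j)
  add : ∀ i < K, ∀ j < K, ClampEq N (v i + v j) (w i + w j)
  mod : ∀ i < K, k ∣ v i - w i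

theorem ClampEq.symm {N a b : ℤ} (h : ClampEq N a b) : ClampEq N b a := by
  unfold ClampEq at *; omega

theorem ClampEq.trans {N a b c : ℤ} (hN : 0 < N) (h : ClampEq N a b) (h' : ClampEq N b c) :
    ClampEq N a c := by
  unfold ClampEq at *; omega

namespace SimilarVal

variable {K : ℕ} {N k : ℤ} {u v w : ℕ → ℤ}

theorem refl (v : ℕ → ℤ) : SimilarVal K N k v v :=
  ⟨fun _ _ => .inl rfl, fun _ _ _ _ => .inl rfl, fun _ _ _ _ => .inl rfl, fun i _ => by simp⟩

theorem symm (h : SimilarVal K N k v w) : SimilarVal K N k w v :=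
  ⟨fun i hi => (h.self i hi).symm, fun i hi j hj => (h.sub i hi j hj).symm,
    fun i hi j hj => (h.add i hi j hj).symm, fun i hi => (dvd_sub_comm).1 (h.mod i hi)⟩

theorem trans (hN : 0 < N) (h : SimilarVal K N k u v) (h' : SimilarVal K N k v w) :
    SimilarVal K N k u w :=
  ⟨fun i hi => (h.self i hi).trans hN (h'.self i hi),
    fun i hi j hj => (h.sub i hi j hj).trans hN (h'.sub i hi j hj),
    fun i hi j hj => (h.add i hi j hj).trans hN (h'.add i hi j hj),
    fun i hi => by have := dvd_add (h.mod i hi) (h'.mod i hi); simpa using this⟩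

end SimilarVal

/-- Below every large absolute value of an entry there is another one at distance less than `G`. -/
def Reduced (K : ℕ) (G : ℤ) (v : ℕ → ℤ) : Prop :=
  ∀ i < K, G ≤ |v i| → ∃ j < K, |v i| - G < |v j| ∧ |v j| < |v i|

/-- Moving the entries of absolute value at least `h` towards `0` by `k`. -/
def shiftDown (h k : ℤ) (v : ℕ → ℤ) (i : ℕ) : ℤ :=
  if h ≤ v i then v i - k else if v i ≤ -h then v i + k else v i

/-- A sum or difference of a small and a large entry has absolute value at least `N + k` before the
move and `N` after it. For two large entries one of sum and difference is unchanged, and the other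
stays beyond `N` with its sign. -/
theorem similar_shiftDown {K : ℕ} {N k h : ℤ} {v : ℕ → ℤ} (hN : 0 < N) (hk : 0 < k)
    (hh : N + k ≤ h) (hgap : ∀ j < K, |v j| ≤ h - (N + k) ∨ h ≤ |v j|) :
    SimilarVal K N k v (shiftDown h k v) := by
  have key : ∀ i < K, (-(h - (N + k)) ≤ v i ∧ v i ≤ h - (N + k) ∧ shiftDown h k v i = v i) ∨
      (h ≤ v i ∧ shiftDown h k v i = v i - k) ∨ (v i ≤ -h ∧ shiftDown h k v i = v i + k) := by
    intro i hi
    have := hgap i hi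
    unfold shiftDown
    split_ifs <;> rcases abs_cases (v i) with h | h <;> omega
  refine ⟨fun i hi => ?_, fun i hi j hj => ?_, fun i hi j hj => ?_, fun i hi => ?_⟩
  · have := key i hi
    unfold ClampEq; omega
  · have h1 := key i hi
    have h2 := key j hj
    unfold ClampEq; omega
  · have h1 := key i hi
    have h2 := key j hj
    unfold ClampEq; omega
  · rcases key i hi with h | h | h
    · rw [h.2.2]; simp
    · rw [h.2]; simp
    · rw [h.2]; simp

/-- Corresponding entries have the same sign, so a difference of absolute values is, up to sign, the
same sum or difference of entries on both sides. This is why similarity also records sums. -/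
theorem SimilarVal.clampEq_abs {K : ℕ} {N k : ℤ} {v w : ℕ → ℤ} (hN : 0 < N)
    (h : SimilarVal K N k v w) {i j : ℕ} (hi : i < K) (hj : j < K) :
    ClampEq N (|v i| - |v j|) (|w i| - |w j|) := by
  have h1 := h.self i hi
  have h2 := h.self j hj
  have h3 := h.sub i hi j hj
  have h4 := h.add i hi j hj
  unfold ClampEq at *
  rcases abs_cases (v i) with e1 | e1 <;> rcases abs_cases (v j) with e2 | e2 <;>
  rcases abs_cases (w i) with e3 | e3 <;> rcases abs_cases (w j) with e4 | e4 <;> omega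

/-- Similar reduced valuations are equal. -/
theorem SimilarVal.eq_of_reduced {K : ℕ} {N k : ℤ} {v w : ℕ → ℤ} (hN : 0 < N) (hk : 0 < k)
    (h : SimilarVal K N k v w) (hv : Reduced K (N + k) v) (hw : Reduced K (N + k) w) :
    ∀ i < K, v i = w i := by
  have key : ∀ n : ℕ, ∀ i < K, (v i).natAbs = n → v i = w i := by
    intro n
    induction n using Nat.strong_induction_on with
    | _ n ih =>
      intro i hi hn
      by_contra hne
      have hs := h.self i hi
      have below : ∀ j < K, |v j| < |v i| → v j = w j := by
        intro j hj hlt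
        refine ih _ ?_ j hj rfl
        rw [Int.abs_eq_natAbs, Int.abs_eq_natAbs] at hlt
        omega
      have hv' : ∃ a, 0 ≤ a ∧ |v i| - (N + k) < a ∧ a < |v i| ∧
          ClampEq N (|v i| - a) (|w i| - a) := by
        by_cases hG : N + k ≤ |v i|
        · obtain ⟨j, hj, h1, h2⟩ := hv i hi hG
          have := h.clampEq_abs hN hi hj
          have e := below j hj h2
          exact ⟨|v j|, abs_nonneg _, h1, h2, by rwa [← e] at this⟩
        · refine ⟨0, le_rfl, by omega, ?_, ?_⟩ <;> unfold ClampEq at * <;>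
            rcases abs_cases (v i) with e1 | e1 <;> rcases abs_cases (w i) with e3 | e3 <;> omega
      have hw' : ∃ a, 0 ≤ a ∧ |w i| - (N + k) < a ∧ a < |w i| ∧
          ClampEq N (|v i| - a) (|w i| - a) := by
        by_cases hG : N + k ≤ |w i|
        · obtain ⟨j, hj, h1, h2⟩ := hw i hi hG
          have := h.clampEq_abs hN hi hj
          have e := below j hj (by unfold ClampEq at this; omega)
          exact ⟨|w j|, abs_nonneg _, h1, h2, by rwa [e] at this⟩
        · refine ⟨0, le_rfl, by omega, ?_, ?_⟩ <;> unfold ClampEq at * <;>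
            rcases abs_cases (v i) with e1 | e1 <;> rcases abs_cases (w i) with e3 | e3 <;> omega
      obtain ⟨a, ha0, ha1, ha2, ha3⟩ := hv'
      obtain ⟨b, hb0, hb1, hb2, hb3⟩ := hw'
      -- A distance to an anchor below `N` would force equality. Otherwise `|v i|` lies in `[a + N,
      -- a + N + k)` while `|w i| ≥ a + N`, and symmetrically with `b`; so the two differ by less
      -- than `k`, and the congruence modulo `k` finishes.
      have hlt : |v i - w i| < k := by
        unfold ClampEq at *
        rw [abs_lt]
        rcases abs_cases (v i) with e1 | e1 <;> rcases abs_cases (w i) with e3 | e3 <;> omega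
      have := Int.eq_zero_of_abs_lt_dvd (h.mod i hi) hlt
      omega
  exact fun i hi => key _ i hi rfl

/-- Descending from a large entry in steps shorter than `G` meets a new, strictly smaller absolute
value each time, and there are only `K` entries. -/
theorem Reduced.abs_lt {K : ℕ} {G : ℤ} {v : ℕ → ℤ} (hG : 0 ≤ G) (hv : Reduced K G v) :
    ∀ i < K, |v i| < G * (K + 1) := by
  have key : ∀ n : ℕ, ∀ i < K, G * n ≤ |v i| →
      n ≤ ((Finset.range K).filter (fun j => |v j| < |v i|)).card := by
    intro n
    induction n with
    | zero => intro i hi _; exact Nat.zero_le _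
    | succ n ih =>
      intro i hi hn
      push_cast at hn
      obtain ⟨j, hj, h1, h2⟩ := hv i hi (by nlinarith)
      have h3 := ih j hj (by linarith)
      refine Nat.lt_of_le_of_lt h3 (Finset.card_lt_card ?_)
      refine Finset.ssubset_iff_subset_ne.2 ⟨?_, ?_⟩
      · intro x hx
        simp only [Finset.mem_filter] at hx ⊢
        exact ⟨hx.1, hx.2.trans h2⟩
      · intro he
        have : j ∈ (Finset.range K).filter (fun x => |v x| < |v i|) := by simp [hj, h2]
        rw [← he] at this
        simp at this
  intro i hi
  by_contra hcon
  have h1 := key (K + 1) i hi (by push_cast; linarith)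
  have h2 := (Finset.card_filter_le (Finset.range K) (fun j => |v j| < |v i|))
  rw [Finset.card_range] at h2
  omega

/-! ### Semantics in terms of expression values and unit delays -/

open Encodable

/-- Truth of a constraint when the linear expression with code `n` has the value `v n`. -/
def AtomicConstraint.HoldsV (c : AtomicConstraint) (v : ℕ → ℤ) (ω : ClockVal) : Prop :=
  c.cmp.Holds ((c.lhs.eval ω : ℤ) : WithTop ℤ)
    (match c.rhs with
      | .lin e => ((v (encode e) : ℤ) : WithTop ℤ)
      | .infty => ⊤)

/-- The values of all linear expressions under `γ`. -/
def exprVal (γ : ParamVal) (n : ℕ) : ℤ := (Denumerable.ofNat LinExpr n).eval γ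

theorem exprVal_encode (γ : ParamVal) (e : LinExpr) : exprVal γ (encode e) = e.eval γ := by
  rw [exprVal, Denumerable.ofNat_encode]

theorem holdsV_exprVal (c : AtomicConstraint) (γ : ParamVal) (ω : ClockVal) :
    c.HoldsV (exprVal γ) ω ↔ c.Holds γ ω := by
  obtain ⟨l, m, e | _⟩ := c <;>
    simp [AtomicConstraint.HoldsV, AtomicConstraint.Holds, exprVal_encode, Expression.eval]

/-- The invariant of location `q` is true under the truth assignment `H`. -/
def PTA.InvHolds (A : PTA) (H : AtomicConstraint → Prop) (q : ℕ) : Prop :=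
  ∃ g, A.inv[q]? = some g ∧ ∀ c ∈ g, H c

/-- The truth value of a state property in location `q` under the truth assignment `H`. -/
def StateProp.Eval (H : AtomicConstraint → Prop) (q : ℕ) : StateProp → Prop
  | .atom c => H c
  | .loc q' => q = q'
  | .not φ => ¬ φ.Eval H q
  | .and φ₁ φ₂ => φ₁.Eval H q ∧ φ₂.Eval H q
  | .or φ₁ φ₂ => φ₁.Eval H q ∨ φ₂.Eval H q

theorem StateProp.eval_congr {H H' : AtomicConstraint → Prop} {q : ℕ} {φ : StateProp}
    (h : ∀ c, φ.HasConstraint c → (H c ↔ H' c)) : φ.Eval H q ↔ φ.Eval H' q := by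
  induction φ with
  | atom c => exact h c rfl
  | loc q => rfl
  | not φ ih => exact not_congr (ih h)
  | and φ₁ φ₂ ih₁ ih₂ =>
    exact and_congr (ih₁ fun c hc => h c (.inl hc)) (ih₂ fun c hc => h c (.inr hc))
  | or φ₁ φ₂ ih₁ ih₂ =>
    exact or_congr (ih₁ fun c hc => h c (.inl hc)) (ih₂ fun c hc => h c (.inr hc))

theorem StateProp.holds_iff_eval (γ : ParamVal) (s : ℕ × ClockVal) (φ : StateProp) :
    φ.Holds γ s ↔ φ.Eval (fun c => c.Holds γ s.2) s.1 := by
  induction φ with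
  | atom c => rfl
  | loc q => rfl
  | not φ ih => exact not_congr ih
  | and φ₁ φ₂ ih₁ ih₂ => exact and_congr ih₁ ih₂
  | or φ₁ φ₂ ih₁ ih₂ => exact or_congr ih₁ ih₂

/-- One unit of time elapses. -/
def tickClocks (ω : ClockVal) : ClockVal := fun x => ω x + 1

/-- Reachability by unit delays and transitions, where `T ω` says which constraints are true at the
clock valuation `ω`. -/
inductive UReach (A : PTA) (T : ClockVal → AtomicConstraint → Prop) : ℕ → ClockVal → Prop
  | init : A.InvHolds (T fun _ => 0) A.init → UReach A T A.init fun _ => 0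
  | tick {q ω} : UReach A T q ω → A.InvHolds (T (tickClocks ω)) q → UReach A T q (tickClocks ω)
  | edge {ω t} : UReach A T t.src ω → t ∈ A.edges → (∀ c ∈ t.guard, T ω c) →
      A.InvHolds (T (applyUpdate ω t.upd)) t.tgt → UReach A T t.tgt (applyUpdate ω t.upd)

/-- Some reachable configuration violates `φ`. -/
def Unsafe (A : PTA) (φ : StateProp) (T : ClockVal → AtomicConstraint → Prop) : Prop :=
  ∃ q ω, UReach A T q ω ∧ ¬ φ.Eval (T ω) q

theorem UReach.inv {A : PTA} {T q ω} (h : UReach A T q ω) : A.InvHolds (T ω) q := by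
  cases h <;> assumption

/-- The left-hand side is monotone or constant along a delay, so the delays satisfying a constraint
form an interval. Hence a delay that respects the invariant at both ends splits into unit delays
that respect it too. -/
theorem AtomicConstraint.holds_between {c : AtomicConstraint} {γ : ParamVal} {ω : ClockVal}
    {i d : ℕ} (hi : i ≤ d) (h0 : c.Holds γ ω) (hd : c.Holds γ fun x => ω x + d) :
    c.Holds γ fun x => ω x + i := by
  obtain ⟨l, m, e | _⟩ := c
  · cases l <;> cases m <;>
      simp only [AtomicConstraint.Holds, Expression.eval, ClockTerm.eval, Comparison.Holds,
        WithTop.coe_lt_coe, WithTop.coe_le_coe, WithTop.coe_eq_coe] at * <;> push_cast at * <;> omega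
  · cases m <;> simp_all [AtomicConstraint.Holds, Expression.eval, Comparison.Holds]

theorem PTA.reachable_iff (A : PTA) (γ : ParamVal) (s : ℕ × ClockVal) :
    (A.semantics γ).Reachable s ↔ UReach A (fun ω c => c.Holds γ ω) s.1 s.2 := by
  constructor
  · rintro ⟨s0, ⟨h0, rfl⟩, h⟩
    induction h with
    | refl => exact .init h0
    | @tail s s' _ h ih =>
      obtain ⟨a | d, hs, hs', h⟩ := h
      · obtain ⟨t, ht, h1, -, h3, h4, h5⟩ := h
        obtain ⟨q, ω⟩ := s
        obtain ⟨q', ω'⟩ := s'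
        simp only at h1 h3 h5
        subst h1 h3 h5
        exact UReach.edge ih ht h4 hs'
      · obtain ⟨q, ω⟩ := s
        obtain ⟨q', ω'⟩ := s'
        simp only at h
        obtain ⟨rfl, rfl⟩ := h
        have key : ∀ i ≤ d, UReach A (fun ω c => c.Holds γ ω) q' (fun x => ω x + i) := by
          intro i
          induction i with
          | zero => intro _; exact ih
          | succ i ihi =>
            intro hi
            refine UReach.tick (ihi (by omega)) ?_
            obtain ⟨g, hg, h1⟩ := hs
            obtain ⟨g', hg', h2⟩ := hs'
            simp only at hg hg'
            obtain rfl : g = g' := by simpa [hg] using hg'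
            exact ⟨g, hg, fun c hc =>
              AtomicConstraint.holds_between (ω := ω) hi (h1 c hc) (h2 c hc)⟩
        exact key d le_rfl
  · obtain ⟨q, ω⟩ := s
    intro h
    simp only at h
    induction h with
    | init h => exact ⟨_, ⟨h, rfl⟩, .refl⟩
    | @tick q ω h hi ih =>
      obtain ⟨s0, h0, hr⟩ := ih
      exact ⟨s0, h0, hr.tail ⟨.inr 1, h.inv, hi, rfl, rfl⟩⟩
    | @edge ω t h ht hg hi ih =>
      obtain ⟨s0, h0, hr⟩ := ih
      exact ⟨s0, h0, hr.tail ⟨.inl t.act, h.inv, hi, t, ht, rfl, rfl, rfl, hg, rfl⟩⟩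

theorem PTA.mem_feasible_iff (A : PTA) (φ : StateProp) (γ : ParamVal) :
    γ ∈ A.feasible (.always φ) ↔ ¬ Unsafe A φ (fun ω c => c.HoldsV (exprVal γ) ω) := by
  simp only [PTA.feasible, Set.mem_ofPred_eq, PTA.Satisfies, PTA.reachable_iff, Unsafe,
    StateProp.holds_iff_eval, holdsV_exprVal]
  push Not
  exact ⟨fun h q ω hr => h (q, ω) hr, fun h s hr => h s.1 s.2 hr⟩

/-- All numerical data of `A` and `φ` are bounded by `K`. -/
structure BoundedBy (A : PTA) (φ : StateProp) (K : ℕ) : Prop where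
  loc : A.inv.length ≤ K
  upd : ∀ t ∈ A.edges, ∀ r ∈ t.upd, r.1 < K ∧ r.2 < K
  clock : ∀ c, A.HasConstraint c ∨ φ.HasConstraint c → ∀ y, c.lhs.Mentions y → y < K
  expr : ∀ c, A.HasConstraint c ∨ φ.HasConstraint c → ∀ e, c.rhs = .lin e →
    encode e < K

/-! ### Finite abstraction of clock valuations -/

section Abstraction

/-- Abstract clock valuations: clock values up to `2 * M` and differences up to `M` of the clocks
below `M`. -/
abbrev AbsVal (M : ℕ) := (Fin M → Fin (2 * M + 1)) × (Fin M → Fin M → Fin (2 * M + 1))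

/-- Values are kept up to `2 * M`, not just `M`, so that resets are compatible: when one clock is
set to some `b < M`, its difference to another clock truncated at `2 * M` is already beyond `M` in
absolute value. -/
def absVal (M : ℕ) (ω : ClockVal) : AbsVal M :=
  (fun y => ⟨min (ω y) (2 * M), by omega⟩,
   fun y z => ⟨(max (-(M : ℤ)) (min M ((ω y : ℤ) - ω z)) + M).toNat, by omega⟩)

theorem absVal_eq_iff {M : ℕ} {ω ω' : ClockVal} : absVal M ω = absVal M ω' ↔
    (∀ y < M, min (ω y) (2 * M) = min (ω' y) (2 * M)) ∧
    (∀ y < M, ∀ z < M, ClampEq M ((ω y : ℤ) - ω z) ((ω' y : ℤ) - ω' z)) := by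
  simp only [absVal, Prod.mk.injEq, funext_iff, Fin.mk.injEq, Fin.forall_iff, ClampEq]
  refine and_congr Iff.rfl (forall₂_congr fun y _ => forall₂_congr fun z _ => ?_)
  omega

variable {M : ℕ} {ω ω' : ClockVal}

theorem absVal_congr (h : ∀ y < M, ω y = ω' y) : absVal M ω = absVal M ω' := by
  rw [absVal_eq_iff]
  refine ⟨fun y hy => by rw [h y hy], fun y hy z hz => by rw [h y hy, h z hz]; exact .inl rfl⟩

theorem absVal_tick (h : absVal M ω = absVal M ω') :
    absVal M (tickClocks ω) = absVal M (tickClocks ω') := by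
  rw [absVal_eq_iff] at *
  obtain ⟨h1, h2⟩ := h
  refine ⟨fun y hy => ?_, fun y hy z hz => ?_⟩
  · have := h1 y hy
    simp only [tickClocks]; omega
  · have := h2 y hy z hz
    simp only [tickClocks, ClampEq] at *
    push_cast
    omega

theorem lookup_mem {u : UpdateSet} {y b : ℕ} (h : u.lookup y = some b) : (y, b) ∈ u := by
  induction u with
  | nil => simp at h
  | cons r u ih =>
    obtain ⟨a, b'⟩ := r
    rw [List.lookup_cons] at h
    split at h
    · rename_i hy
      simp_all
    · exact List.mem_cons_of_mem _ (ih h)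

theorem absVal_update {u : UpdateSet} (hu : ∀ r ∈ u, r.2 < M) (h : absVal M ω = absVal M ω') :
    absVal M (applyUpdate ω u) = absVal M (applyUpdate ω' u) := by
  rw [absVal_eq_iff] at *
  obtain ⟨h1, h2⟩ := h
  have key : ∀ y, (∃ b < M, applyUpdate ω u y = b ∧ applyUpdate ω' u y = b) ∨
      (applyUpdate ω u y = ω y ∧ applyUpdate ω' u y = ω' y) := by
    intro y
    unfold applyUpdate
    cases hb : u.lookup y with
    | none => exact .inr ⟨rfl, rfl⟩
    | some b => exact .inl ⟨b, hu _ (lookup_mem hb), rfl, rfl⟩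
  refine ⟨fun y hy => ?_, fun y hy z hz => ?_⟩
  · have := h1 y hy
    rcases key y with ⟨b, _, e1, e2⟩ | ⟨e1, e2⟩ <;> rw [e1, e2]
    exact this
  · have a1 := h1 y hy
    have a2 := h1 z hz
    have a3 := h2 y hy z hz
    unfold ClampEq at *
    rcases key y with ⟨b, _, e1, e2⟩ | ⟨e1, e2⟩ <;>
      rcases key z with ⟨b', _, e3, e4⟩ | ⟨e3, e4⟩ <;> rw [e1, e2, e3, e4] <;> omega

theorem holdsV_congr_abs {v : ℕ → ℤ} {c : AtomicConstraint} (hc : ∀ y, c.lhs.Mentions y → y < M)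
    (hv : ∀ e, c.rhs = .lin e → |v (encode e)| < M) (h : absVal M ω = absVal M ω') :
    c.HoldsV v ω ↔ c.HoldsV v ω' := by
  rw [absVal_eq_iff] at h
  obtain ⟨h1, h2⟩ := h
  obtain ⟨l, m, e | _⟩ := c
  · have hv' := abs_lt.1 (hv e rfl)
    cases l with
    | pos x =>
      have := h1 x (hc x rfl)
      cases m <;>
        simp only [AtomicConstraint.HoldsV, ClockTerm.eval, Comparison.Holds,
          WithTop.coe_lt_coe, WithTop.coe_le_coe, WithTop.coe_eq_coe] <;> omega
    | neg x =>
      have := h1 x (hc x rfl)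
      cases m <;>
        simp only [AtomicConstraint.HoldsV, ClockTerm.eval, Comparison.Holds,
          WithTop.coe_lt_coe, WithTop.coe_le_coe, WithTop.coe_eq_coe] <;> omega
    | diff x y =>
      have := h2 x (hc x (.inl rfl)) y (hc y (.inr rfl))
      unfold ClampEq at this
      cases m <;>
        simp only [AtomicConstraint.HoldsV, ClockTerm.eval, Comparison.Holds,
          WithTop.coe_lt_coe, WithTop.coe_le_coe, WithTop.coe_eq_coe] <;> omega
  · cases m <;> simp [AtomicConstraint.HoldsV, Comparison.Holds]

end Abstraction

/-! ### Letters of the parametric clock and abstract reachability -/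

/-- The linear expressions without parameters have their constant values. -/
def Genuine (K : ℕ) (v : ℕ → ℤ) : Prop :=
  ∀ e : LinExpr, encode e < K → ¬ (Expression.lin e).IsParametric → v (encode e) = e.const

def constVal (n : ℕ) : ℤ := (Denumerable.ofNat LinExpr n).const

theorem constVal_encode (e : LinExpr) : constVal (encode e) = e.const := by
  rw [constVal, Denumerable.ofNat_encode]

theorem abs_int_le_encode (z : ℤ) : |z| ≤ encode z := by
  have h : encode z = Equiv.intEquivNat z := rfl
  rw [h]
  cases z with
  | ofNat n =>
    have : Equiv.intEquivNat (Int.ofNat n) = 2 * n := rfl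
    rw [this]
    simp
    omega
  | negSucc n =>
    have : Equiv.intEquivNat (Int.negSucc n) = 2 * n + 1 := rfl
    rw [this, Int.abs_eq_natAbs]
    simp
    omega

theorem abs_const_le_encode (e : LinExpr) : |e.const| ≤ encode e :=
  (abs_int_le_encode e.const).trans (by exact_mod_cast Nat.left_le_pair _ (encode e.terms))

/-- The constraint `c` occurs in `A` or in `φ`. -/
def Occurs (A : PTA) (φ : StateProp) (c : AtomicConstraint) : Prop :=
  A.HasConstraint c ∨ φ.HasConstraint c

/-- The parametric constraints that are true when the parametric clock has the value `t`. -/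
def letterAt (A : PTA) (φ : StateProp) (v : ℕ → ℤ) (t : ℕ) (c : AtomicConstraint) : Prop :=
  Occurs A φ c ∧ c.rhs.IsParametric ∧ c.HoldsV v (fun _ => t)

/-- Truth of constraints when the letter decides the parametric ones. -/
def Mixed (l : AtomicConstraint → Prop) (ω : ClockVal) (c : AtomicConstraint) : Prop :=
  (c.rhs.IsParametric ∧ l c) ∨ (¬ c.rhs.IsParametric ∧ c.HoldsV constVal ω)

theorem PTA.invHolds_congr {A : PTA} {H H' : AtomicConstraint → Prop} {q : ℕ}
    (h : ∀ c, A.HasConstraint c → (H c ↔ H' c)) : A.InvHolds H q ↔ A.InvHolds H' q := by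
  refine exists_congr fun g => and_congr_right fun hg => forall₂_congr fun c hc => ?_
  exact h c (.inl ⟨g, List.mem_of_getElem? hg, hc⟩)

theorem PTA.InvHolds.lt {A : PTA} {H : AtomicConstraint → Prop} {q : ℕ} (h : A.InvHolds H q) :
    q < A.inv.length := by
  obtain ⟨g, hg, -⟩ := h
  exact (List.getElem?_eq_some_iff.1 hg).1

section

variable {A : PTA} {φ : StateProp} {K x : ℕ} {v : ℕ → ℤ}

/-- All clocks of a parametric constraint equal `x`, so its truth is unchanged if every clock is
given the value of `x`, as in `letterAt`. A nonparametric constraint sees only its constant, by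
`Genuine`. -/
theorem mixed_letterAt_iff (hb : BoundedBy A φ K) (hx : ∀ y, IsParametricClock A φ y → y = x)
    (hv : Genuine K v) {c : AtomicConstraint} (hc : Occurs A φ c) (ω : ClockVal) :
    Mixed (letterAt A φ v (ω x)) ω c ↔ c.HoldsV v ω := by
  by_cases hp : c.rhs.IsParametric
  · have he : c.lhs.eval (fun _ => ω x) = c.lhs.eval ω := by
      have hm : ∀ y, c.lhs.Mentions y → ω x = ω y := fun y hy => by
        rw [hx y ⟨c, hc, hp, hy⟩]
      obtain ⟨l, m, r⟩ := c
      cases l with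
      | pos y => simp [ClockTerm.eval, hm y rfl]
      | neg y => simp [ClockTerm.eval, hm y rfl]
      | diff y z => simp [ClockTerm.eval, ← hm y (.inl rfl), ← hm z (.inr rfl)]
    simp [Mixed, letterAt, hp, hc, AtomicConstraint.HoldsV, he]
  · have := fun e he => hv e (hb.expr c hc e he) (he ▸ hp)
    obtain ⟨l, m, e | _⟩ := c
    · simp [Mixed, hp, AtomicConstraint.HoldsV, constVal_encode, this e rfl]
    · simp [Mixed, hp, AtomicConstraint.HoldsV]

theorem mixed_congr (hb : BoundedBy A φ K) {l : AtomicConstraint → Prop} {ω ω' : ClockVal}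
    (h : absVal K ω = absVal K ω') {c : AtomicConstraint} (hc : Occurs A φ c) :
    Mixed l ω c ↔ Mixed l ω' c := by
  unfold Mixed
  rw [holdsV_congr_abs (hb.clock c hc) (fun e he => ?_) h]
  rw [constVal_encode]
  exact lt_of_le_of_lt (abs_const_le_encode e) (by exact_mod_cast hb.expr c hc e he)

/-- Abstract states: a location and an abstract clock valuation. -/
abbrev AbsState (M : ℕ) := Fin (M + 1) × AbsVal M

def absState (M q : ℕ) (ω : ClockVal) : AbsState M := (Fin.ofNat (M + 1) q, absVal M ω)

theorem absState_inj {M q q' : ℕ} {ω ω' : ClockVal} (hq : q ≤ M) (hq' : q' ≤ M)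
    (h : absState M q ω = absState M q' ω') : q = q' ∧ absVal M ω = absVal M ω' := by
  simp only [absState, Prod.mk.injEq, Fin.ext_iff, Fin.val_ofNat] at h
  rw [Nat.mod_eq_of_lt (by omega), Nat.mod_eq_of_lt (by omega)] at h
  exact h

variable (A K) in
def AbsInit (l : AtomicConstraint → Prop) (s : AbsState K) : Prop :=
  s = absState K A.init (fun _ => 0) ∧ A.InvHolds (Mixed l fun _ => 0) A.init

-- Transitions that do not reset `x`: the counter, and hence the letter, stays the same for guard
-- and target invariant. In `AbsReset` the guard is read with the old letter and the invariant with
-- the new one.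
variable (A K x) in
def AbsJump (l : AtomicConstraint → Prop) (s s' : AbsState K) : Prop :=
  ∃ t ∈ A.edges, ∃ ω, t.src < K ∧ s = absState K t.src ω ∧ t.upd.lookup x = none ∧
    (∀ c ∈ t.guard, Mixed l ω c) ∧ A.InvHolds (Mixed l (applyUpdate ω t.upd)) t.tgt ∧
    s' = absState K t.tgt (applyUpdate ω t.upd)

variable (A K) in
def AbsTick (_ l' : AtomicConstraint → Prop) (s s' : AbsState K) : Prop :=
  ∃ q < K, ∃ ω, s = absState K q ω ∧ A.InvHolds (Mixed l' (tickClocks ω)) q ∧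
    s' = absState K q (tickClocks ω)

variable (A K x) in
def AbsReset (l l' : AtomicConstraint → Prop) (b : ℕ) (s s' : AbsState K) : Prop :=
  ∃ t ∈ A.edges, ∃ ω, t.src < K ∧ s = absState K t.src ω ∧ t.upd.lookup x = some b ∧
    (∀ c ∈ t.guard, Mixed l ω c) ∧ A.InvHolds (Mixed l' (applyUpdate ω t.upd)) t.tgt ∧
    s' = absState K t.tgt (applyUpdate ω t.upd)

variable (φ K) in
def AbsBad (l : AtomicConstraint → Prop) (s : AbsState K) : Prop :=
  ∃ q < K, ∃ ω, s = absState K q ω ∧ ¬ φ.Eval (Mixed l ω) q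

variable (A K x) in
/-- Reachability of abstract states with the exact value of the parametric clock. -/
abbrev AbsReach (a : ℕ → AtomicConstraint → Prop) : AbsState K → ℕ → Prop :=
  CReach (AbsInit A K) (AbsJump A K x) (AbsTick A K) (AbsReset A K x) a

theorem UReach.absReach (hb : BoundedBy A φ K) (hx : ∀ y, IsParametricClock A φ y → y = x)
    (hv : Genuine K v) {q : ℕ} {ω : ClockVal} (h : UReach A (fun ω c => c.HoldsV v ω) q ω) :
    AbsReach A K x (letterAt A φ v) (absState K q ω) (ω x) := by
  have hm := fun {ω c} (hc : Occurs A φ c) => mixed_letterAt_iff hb hx hv hc ω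
  have hlt : ∀ {q ω}, UReach A (fun ω c => c.HoldsV v ω) q ω → q < K := fun h =>
    h.inv.lt.trans_le hb.loc
  have hmi : ∀ {ω q}, A.InvHolds (fun c => c.HoldsV v ω) q →
      A.InvHolds (Mixed (letterAt A φ v (ω x)) ω) q := fun h =>
    (PTA.invHolds_congr fun c hc => (hm (.inl hc)).symm).1 h
  induction h with
  | init hi => exact .init ⟨rfl, hmi hi⟩
  | @tick q ω h hi ih => exact .tick ih ⟨q, hlt h, ω, rfl, hmi hi, rfl⟩
  | @edge ω t h ht hg hi ih =>
    have hg' : ∀ c ∈ t.guard, Mixed (letterAt A φ v (ω x)) ω c := fun c hc =>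
      (hm (.inl (.inr ⟨t, ht, hc⟩))).2 (hg c hc)
    have hi' := hmi hi
    cases hl : t.upd.lookup x with
    | none =>
      have he : applyUpdate ω t.upd x = ω x := by simp [applyUpdate, hl]
      rw [he] at hi' ⊢
      exact .jump ih ⟨t, ht, ω, hlt h, rfl, hl, hg', hi', rfl⟩
    | some b =>
      have he : applyUpdate ω t.upd x = b := by simp [applyUpdate, hl]
      rw [he] at hi' ⊢
      exact .reset ih ⟨t, ht, ω, hlt h, rfl, hl, hg', hi', rfl⟩

/-- An abstract step is witnessed by some representative `ω₁`, which may differ from the valuation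
`ω` reached so far. Both have the same abstraction, so the step can be repeated from `ω`, whose
value at `x` is exactly the counter. -/
theorem CReach.exists_uReach (hb : BoundedBy A φ K)
    (hx : ∀ y, IsParametricClock A φ y → y = x) (hv : Genuine K v) {s : AbsState K} {t : ℕ}
    (h : AbsReach A K x (letterAt A φ v) s t) :
    ∃ q ω, s = absState K q ω ∧ ω x = t ∧ UReach A (fun ω c => c.HoldsV v ω) q ω := by
  have hm := fun {ω c} (hc : Occurs A φ c) => mixed_letterAt_iff hb hx hv hc ω
  have hle : ∀ {q ω}, UReach A (fun ω c => c.HoldsV v ω) q ω → q ≤ K := fun h =>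
    (h.inv.lt.trans_le hb.loc).le
  have hmi : ∀ {ω₁ ω q}, absVal K ω = absVal K ω₁ →
      A.InvHolds (Mixed (letterAt A φ v (ω x)) ω₁) q → A.InvHolds (fun c => c.HoldsV v ω) q :=
    fun he h => (PTA.invHolds_congr fun c hc =>
      (mixed_congr hb he.symm (.inl hc)).trans (hm (.inl hc))).1 h
  have hedge : ∀ {e : Edge} {q ω ω₁}, e ∈ A.edges → UReach A (fun ω c => c.HoldsV v ω) q ω →
      e.src < K → absState K q ω = absState K e.src ω₁ →
      (∀ c ∈ e.guard, Mixed (letterAt A φ v (ω x)) ω₁ c) →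
      A.InvHolds (Mixed (letterAt A φ v (applyUpdate ω e.upd x)) (applyUpdate ω₁ e.upd)) e.tgt →
      absState K e.tgt (applyUpdate ω₁ e.upd) = absState K e.tgt (applyUpdate ω e.upd) ∧
        UReach A (fun ω c => c.HoldsV v ω) e.tgt (applyUpdate ω e.upd) := by
    intro e q ω ω₁ he hr hs hab hg hi
    obtain ⟨rfl, hω⟩ := absState_inj (hle hr) hs.le hab
    have hω' := absVal_update (u := e.upd) (fun r hr => (hb.upd e he r hr).2) hω
    exact ⟨by simp only [absState, hω'], hr.edge he
      (fun c hc => (hm (.inl (.inr ⟨e, he, hc⟩))).1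
        ((mixed_congr hb hω (.inl (.inr ⟨e, he, hc⟩))).2 (hg c hc))) (hmi hω' hi)⟩
  induction h with
  | init hi => exact ⟨_, _, hi.1, rfl, .init (hmi (ω := fun _ => 0) rfl hi.2)⟩
  | jump _ hj ih =>
    obtain ⟨q, ω, rfl, rfl, hr⟩ := ih
    obtain ⟨e, he, ω₁, hs, hab, hl, hg, hi, rfl⟩ := hj
    have hex : applyUpdate ω e.upd x = ω x := by simp [applyUpdate, hl]
    obtain ⟨h1, h2⟩ := hedge he hr hs hab hg (by rwa [hex])
    exact ⟨_, _, h1, hex, h2⟩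
  | tick _ hj ih =>
    obtain ⟨q, ω, rfl, rfl, hr⟩ := ih
    obtain ⟨q', hq', ω₁, hab, hi, rfl⟩ := hj
    obtain ⟨rfl, hω⟩ := absState_inj (hle hr) hq'.le hab
    have hω' := absVal_tick hω
    exact ⟨q, tickClocks ω, by simp only [absState, hω'], rfl, hr.tick (hmi hω' hi)⟩
  | @reset s s' t b _ hj ih =>
    obtain ⟨q, ω, rfl, rfl, hr⟩ := ih
    obtain ⟨e, he, ω₁, hs, hab, hl, hg, hi, rfl⟩ := hj
    have hex : applyUpdate ω e.upd x = b := by simp [applyUpdate, hl]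
    obtain ⟨h1, h2⟩ := hedge he hr hs hab hg (by rwa [hex])
    exact ⟨_, _, h1, hex, h2⟩

/-- After this reduction `v` enters only through the sequence of its letters. -/
theorem unsafe_iff_absReach (hb : BoundedBy A φ K)
    (hx : ∀ y, IsParametricClock A φ y → y = x) (hv : Genuine K v) :
    Unsafe A φ (fun ω c => c.HoldsV v ω) ↔ ∃ s t,
      AbsReach A K x (letterAt A φ v) s t ∧ AbsBad φ K (letterAt A φ v t) s := by
  have hm := fun {ω c} (hc : Occurs A φ c) => mixed_letterAt_iff hb hx hv hc ω
  constructor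
  · rintro ⟨q, ω, h, hbad⟩
    refine ⟨_, _, h.absReach hb hx hv, q, h.inv.lt.trans_le hb.loc, ω, rfl, ?_⟩
    rwa [StateProp.eval_congr fun c hc => hm (.inr hc)]
  · rintro ⟨s, t, h, hbad⟩
    obtain ⟨q, ω, rfl, rfl, hr⟩ := h.exists_uReach hb hx hv
    obtain ⟨q', hq', ω₁, hab, hbad⟩ := hbad
    obtain ⟨rfl, hω⟩ := absState_inj (hr.inv.lt.trans_le hb.loc).le hq'.le hab
    refine ⟨q, ω, hr, ?_⟩
    rwa [StateProp.eval_congr fun c hc =>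
      (hm (.inr hc)).symm.trans (mixed_congr hb hω (.inr hc))]

/-- The three comparisons belong to the three shapes of a parametric left-hand side: `x`, `-x`, and
`x - x = 0`. -/
theorem letterAt_congr (hb : BoundedBy A φ K) {v' : ℕ → ℤ} {t t' : ℕ}
    (h : ∀ i < K, ((t < v i ↔ t' < v' i) ∧ (v i < t ↔ v' i < t')) ∧
      ((-t < v i ↔ -t' < v' i) ∧ (v i < -t ↔ v' i < -t')) ∧
      (0 < v i ↔ 0 < v' i) ∧ (v i < 0 ↔ v' i < 0)) :
    letterAt A φ v t = letterAt A φ v' t' := by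
  funext c
  refine propext (and_congr_right fun hc => and_congr_right fun hp => ?_)
  have he := fun e hr => h _ (hb.expr c hc e hr)
  obtain ⟨l, m, e | _⟩ := c
  · have := he e rfl
    cases l <;> cases m <;>
      simp only [AtomicConstraint.HoldsV, ClockTerm.eval, Comparison.Holds,
        WithTop.coe_lt_coe, WithTop.coe_le_coe, WithTop.coe_eq_coe] <;> omega
  · cases m <;> simp [AtomicConstraint.HoldsV, Comparison.Holds]

/-- Moving the large values does not affect safety, as long as the gap below them is changed only
in ways that iterated images cannot notice. -/
theorem Unsafe.shift (hb : BoundedBy A φ K) (hx : ∀ y, IsParametricClock A φ y → y = x)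
    {v' : ℕ → ℤ} (hv : Genuine K v) (hv' : Genuine K v') {p g g' : ℕ} (hp : K ≤ p)
    (hvv : ∀ i < K, (|v i| < p ∧ v' i = v i) ∨ (p + g < v i ∧ v' i = v i - g + g') ∨
      (v i < -(p + g) ∧ v' i = v i + g - g'))
    (hT : ∀ (f : Set (AbsState K) → Set (AbsState K)) U, f^[g] U = f^[g'] U ∧
      ∀ j, j ≤ g → ∃ j' ≤ g', f^[j] U = f^[j'] U)
    (h : Unsafe A φ (fun ω c => c.HoldsV v ω)) : Unsafe A φ (fun ω c => c.HoldsV v' ω) := by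
  rw [unsafe_iff_absReach hb hx hv] at h
  rw [unsafe_iff_absReach hb hx hv']
  obtain ⟨s, t, hr, hbad⟩ := h
  have hvv' : ∀ i < K, (-(p : ℤ) < v i ∧ v i < p ∧ v' i = v i) ∨
      (p + g < v i ∧ v' i = v i - g + g') ∨ (v i < -(p + g) ∧ v' i = v i + g - g') := by
    intro i hi
    have := hvv i hi
    rw [abs_lt, and_assoc] at this
    exact this
  have hshift := CReach.shift (a := letterAt A φ v) (a' := letterAt A φ v') (p := p) (g := g)
    (g' := g') ?_ ?_ ?_ ?_ ?_ (fun U j hj => (hT _ U).2 j hj) (fun U => (hT _ U).1) hr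
  · obtain ⟨t', ht', hr'⟩ := hshift
    exact ⟨s, t', hr', by rwa [← ht']⟩
  -- Resets assign constants below `K ≤ p`, so they never jump into or past the gap.
  · rintro l l' b s s' ⟨t, ht, ω, -, -, hl, -⟩
    have := (hb.upd t ht _ (lookup_mem hl)).2
    simp only at this
    omega
  -- No entry of `v` has absolute value in `[p, p + g]` and none of `v'` in `[p, p + g']`; all
  -- entries beyond are displaced by the same amount.
  all_goals
    intros
    refine letterAt_congr hb fun i hi => ?_
    have := hvv' i hi
    push_cast
    omega

theorem Unsafe.congr (hb : BoundedBy A φ K) (hx : ∀ y, IsParametricClock A φ y → y = x)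
    {v' : ℕ → ℤ} (hv : Genuine K v) (hv' : Genuine K v') (h : ∀ i < K, v i = v' i) :
    Unsafe A φ (fun ω c => c.HoldsV v ω) ↔ Unsafe A φ (fun ω c => c.HoldsV v' ω) := by
  rw [unsafe_iff_absReach hb hx hv, unsafe_iff_absReach hb hx hv']
  have : letterAt A φ v = letterAt A φ v' := by
    funext t
    exact letterAt_congr hb fun i hi => by simp [h i hi]
  rw [this]

/-- The constant of an expression with code below `K` is itself below `K ≤ N` in absolute value, so
truncation at `N` determines it. -/
theorem Genuine.similar {N k : ℤ} {w : ℕ → ℤ} (hN : K ≤ N)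
    (h : SimilarVal K N k v w) (hv : Genuine K v) : Genuine K w := by
  intro e he hp
  have h1 := h.self _ he
  have h2 := abs_le.1 (abs_const_le_encode e)
  rw [hv e he hp] at h1
  unfold ClampEq at h1
  omega

end

/-! ### Shrinking gaps, and invariance of safety under similarity -/

/-- A bound for the number of sets of abstract states. -/
def setBound (M : ℕ) : ℕ :=
  2 ^ ((M + 1) * ((2 * M + 1) ^ M * ((2 * M + 1) ^ M) ^ M))

theorem two_pow_card_absState (M : ℕ) : 2 ^ Fintype.card (AbsState M) = setBound M := by
  simp [setBound, AbsState, AbsVal]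

def period (K : ℕ) : ℕ := (setBound K).factorial

def threshold (K : ℕ) : ℕ := setBound K + period K + K + 2

theorem iterate_gap (K : ℕ) (f : Set (AbsState K) → Set (AbsState K)) (U : Set (AbsState K))
    {g g' : ℕ} (hg : setBound K + period K ≤ g) (hg' : setBound K + period K ≤ g')
    (h : g = g' + period K ∨ g' = g + period K) :
    f^[g] U = f^[g'] U ∧ ∀ j, j ≤ g → ∃ j' ≤ g', f^[j] U = f^[j'] U := by
  classical
  have hper : ∀ n, setBound K ≤ n → f^[n + period K] U = f^[n] U := fun n hn =>
    iterate_add_factorial f (C := setBound K) (by simp [← two_pow_card_absState]) U hn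
  have hpos : 0 < period K := Nat.factorial_pos _
  rcases h with rfl | rfl
  · refine ⟨hper _ (by omega), fun j hj => ?_⟩
    by_cases hj' : j ≤ g'
    · exact ⟨j, hj', rfl⟩
    · refine ⟨j - period K, by omega, ?_⟩
      have := hper (j - period K) (by omega)
      rwa [Nat.sub_add_cancel (by omega)] at this
  · exact ⟨(hper _ (by omega)).symm, fun j hj => ⟨j, by omega, rfl⟩⟩

section

variable {A : PTA} {φ : StateProp} {K x : ℕ} {v : ℕ → ℤ}

/-- `Unsafe.shift` is used in both directions, with gap lengths `g + period K` and `g`; both are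
long enough for the iterated images to have become periodic. -/
theorem unsafe_shiftDown_iff (hb : BoundedBy A φ K)
    (hx : ∀ y, IsParametricClock A φ y → y = x) (hv : Genuine K v) {h : ℤ}
    (hh : (threshold K : ℤ) + period K ≤ h)
    (hgap : ∀ j < K, |v j| ≤ h - (threshold K + period K) ∨ h ≤ |v j|) :
    Genuine K (shiftDown h (period K) v) ∧ (Unsafe A φ (fun ω c => c.HoldsV v ω) ↔
      Unsafe A φ (fun ω c => c.HoldsV (shiftDown h (period K) v) ω)) := by
  have hpos : 0 < period K := Nat.factorial_pos _
  have hsim := similar_shiftDown (K := K) (N := threshold K) (k := period K) (v := v)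
    (by unfold threshold; omega) (by omega) hh hgap
  have hv' : Genuine K (shiftDown h (period K) v) :=
    Genuine.similar (by unfold threshold; omega) hsim hv
  refine ⟨hv', ?_⟩
  -- The summand `K` puts all reset constants below `p`, and `1` makes the small entries strictly
  -- smaller than `p`. With `g = setBound K + period K` one gets `p + g + period K = h - 1`,
  -- strictly below the large entries; this accounts for `K + 2` in `threshold`.
  obtain ⟨p, hp⟩ : ∃ p : ℕ, (p : ℤ) = h - (threshold K + period K) + K + 1 :=
    ⟨(h - (threshold K + period K) + K + 1).toNat, by omega⟩
  obtain ⟨g, hg⟩ : ∃ g : ℕ, g = setBound K + period K := ⟨_, rfl⟩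
  have hN : threshold K = g + K + 2 := by rw [hg, threshold]
  have key : ∀ i < K,
      (|v i| < p ∧ |shiftDown h (period K) v i| < p ∧ shiftDown h (period K) v i = v i) ∨
      (p + (g + period K) < v i ∧ shiftDown h (period K) v i = v i - period K) ∨
      (v i < -(p + (g + period K)) ∧ shiftDown h (period K) v i = v i + period K) := by
    intro i hi
    have := hgap i hi
    unfold shiftDown
    split_ifs <;> rcases abs_cases (v i) with h | h <;> omega
  constructor
  · refine Unsafe.shift (g := g + period K) (g' := g) (p := p) hb hx hv hv' (by omega) ?_ ?_
    · intro i hi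
      have := key i hi
      push_cast
      omega
    · exact fun f U => iterate_gap K f U (by omega) (by omega) (.inl rfl)
  · refine Unsafe.shift (g := g) (g' := g + period K) (p := p) hb hx hv' hv (by omega) ?_ ?_
    · intro i hi
      have := key i hi
      push_cast
      omega
    · exact fun f U => iterate_gap K f U (by omega) (by omega) (.inr rfl)

/-- Failure of reducedness at `i` is exactly a long gap below `|v i|`. Moving everything from `|v
i|` on towards `0` decreases the sum of absolute values, so the process ends. -/
theorem exists_reduced (hb : BoundedBy A φ K)
    (hx : ∀ y, IsParametricClock A φ y → y = x) (hv : Genuine K v) :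
    ∃ w, Genuine K w ∧ Reduced K (threshold K + period K) w ∧
      SimilarVal K (threshold K) (period K) v w ∧ (Unsafe A φ (fun ω c => c.HoldsV v ω) ↔
        Unsafe A φ (fun ω c => c.HoldsV w ω)) := by
  have hpos : 0 < period K := Nat.factorial_pos _
  have hN : (0 : ℤ) < threshold K := by unfold threshold; omega
  induction hn : ∑ i ∈ Finset.range K, (v i).natAbs using Nat.strong_induction_on generalizing v with
  | _ n ih =>
    by_cases hr : Reduced K (threshold K + period K) v
    · exact ⟨v, hv, hr, .refl v, Iff.rfl⟩
    unfold Reduced at hr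
    push Not at hr
    obtain ⟨i, hi, hG, hgap⟩ := hr
    have hgap' : ∀ j < K, |v j| ≤ |v i| - (threshold K + period K) ∨ |v i| ≤ |v j| := by
      intro j hj
      rcases lt_or_ge (|v i| - (threshold K + period K)) |v j| with h | h
      · exact .inr (hgap j hj h)
      · exact .inl h
    obtain ⟨h1, h2⟩ := unsafe_shiftDown_iff hb hx hv hG hgap'
    have hle : ∀ j < K, (shiftDown |v i| (period K) v j).natAbs ≤ (v j).natAbs := by
      intro j hj
      unfold shiftDown
      split_ifs <;> omega
    have hlt : (shiftDown |v i| (period K) v i).natAbs < (v i).natAbs := by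
      unfold shiftDown
      split_ifs with ha hb <;> rcases abs_cases (v i) with h | h <;> omega
    have hsum : ∑ i' ∈ Finset.range K, (shiftDown |v i| (period K) v i').natAbs < n := by
      rw [← hn]
      exact Finset.sum_lt_sum (fun j hj => hle j (Finset.mem_range.1 hj))
        ⟨i, Finset.mem_range.2 hi, hlt⟩
    obtain ⟨w, hw, hred, hsim, hiff⟩ := ih _ hsum h1 rfl
    exact ⟨w, hw, hred, (similar_shiftDown hN (by omega) hG hgap').trans hN hsim, h2.trans hiff⟩

/-- The reduced forms of `v` and `w` are similar by transitivity, hence equal below `K`, and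
reduction preserves safety. -/
theorem unsafe_iff_of_similar (hb : BoundedBy A φ K)
    (hx : ∀ y, IsParametricClock A φ y → y = x) (hv : Genuine K v) {w : ℕ → ℤ}
    (h : SimilarVal K (threshold K) (period K) v w) :
    Unsafe A φ (fun ω c => c.HoldsV v ω) ↔ Unsafe A φ (fun ω c => c.HoldsV w ω) := by
  have hpos : 0 < period K := Nat.factorial_pos _
  have hN : (0 : ℤ) < threshold K := by unfold threshold; omega
  have hw : Genuine K w := Genuine.similar (by unfold threshold; omega) h hv
  obtain ⟨v', hv', hr, hs, hi⟩ := exists_reduced hb hx hv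
  obtain ⟨w', hw', hr', hs', hi'⟩ := exists_reduced hb hx hw
  rw [hi, hi']
  exact Unsafe.congr hb hx hv' hw'
    (((hs.symm.trans hN h).trans hN hs').eq_of_reduced hN (by omega) hr hr')

end

/-- A parameter may occur in several terms whose coefficients cancel. Grouping by parameter shows
that an expression with all total coefficients zero is constant. -/
theorem sum_terms_eq (l : List (ℕ × ℤ)) (γ : ParamVal) (P : Finset ℕ) (hP : ∀ t ∈ l, t.1 ∈ P) :
    (l.map (fun t => t.2 * γ t.1)).sum =
      ∑ p ∈ P, ((l.filter (fun t => t.1 = p)).map Prod.snd).sum * γ p := by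
  induction l with
  | nil => simp
  | cons t l ih =>
    rw [List.map_cons, List.sum_cons, ih fun t' ht' => hP t' (List.mem_cons_of_mem _ ht')]
    have : ∀ p, (((t :: l).filter (fun t => t.1 = p)).map Prod.snd).sum * γ p =
        (if t.1 = p then t.2 * γ p else 0) +
          ((l.filter (fun t => t.1 = p)).map Prod.snd).sum * γ p := by
      intro p
      by_cases h : t.1 = p <;> simp [h, add_mul]
    simp_rw [this, Finset.sum_add_distrib]
    rw [Finset.sum_ite_eq, if_pos (hP t (by simp))]

theorem genuine_exprVal (K : ℕ) (γ : ParamVal) : Genuine K (exprVal γ) := by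
  intro e _ hp
  have hp' : ∀ p, e.cf p = 0 := by simpa [Expression.IsParametric] using hp
  rw [exprVal_encode, LinExpr.eval, sum_terms_eq e.terms γ (e.terms.map Prod.fst).toFinset
    (fun t ht => by simpa using ⟨t.2, ht⟩)]
  simp only [LinExpr.cf] at hp'
  simp [hp']

/-! ### Deciding safety of one valuation by bounded search -/

def clockVal (l : List ℕ) : ClockVal := fun y => l.getD y 0

def listVal (w : List ℤ) (n : ℕ) : ℤ := w.getD n 0

/-- The values of the clocks below `M`. -/
def trunc (M : ℕ) (ω : ClockVal) : List ℕ := (List.range M).map ω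

theorem clockVal_trunc {M : ℕ} {ω : ClockVal} {y : ℕ} (hy : y < M) :
    clockVal (trunc M ω) y = ω y := by
  simp [clockVal, trunc, List.getD, hy]

theorem trunc_congr {M : ℕ} {ω ω' : ClockVal} (h : ∀ y < M, ω y = ω' y) :
    trunc M ω = trunc M ω' :=
  List.map_congr_left fun y hy => h y (List.mem_range.1 hy)

/-- Truth of a constraint for listed values of expressions and clocks. -/
def Truth (w : List ℤ) (l : List ℕ) (c : AtomicConstraint) : Prop :=
  c.HoldsV (listVal w) (clockVal l)

open Classical in
/-- A configuration and its successors; the clocks from `M` on are dropped. -/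
noncomputable def searchStep (A : PTA) (w : List ℤ) (M : ℕ) (s : ℕ × List ℕ) :
    List (ℕ × List ℕ) :=
  -- Disabled moves return `s`, which is in the list anyway; keeping `s` makes the search
  -- cumulative.
  s :: (if A.InvHolds (Truth w (trunc M (tickClocks (clockVal s.2)))) s.1 then
      (s.1, trunc M (tickClocks (clockVal s.2))) else s) ::
    A.edges.map fun t => if t.src = s.1 ∧ (∀ c ∈ t.guard, Truth w s.2 c) ∧
        A.InvHolds (Truth w (trunc M (applyUpdate (clockVal s.2) t.upd))) t.tgt then
      (t.tgt, trunc M (applyUpdate (clockVal s.2) t.upd)) else s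

open Classical in
noncomputable def searchInit (A : PTA) (w : List ℤ) (M : ℕ) : List (ℕ × List ℕ) :=
  if A.InvHolds (Truth w (trunc M fun _ => 0)) A.init then [(A.init, trunc M fun _ => 0)] else []

/-- The configurations that are reachable in at most `n` steps. -/
noncomputable def search (A : PTA) (w : List ℤ) (M n : ℕ) : List (ℕ × List ℕ) :=
  (fun L => L.flatMap (searchStep A w M))^[n] (searchInit A w M)

theorem mem_searchStep {A : PTA} {w : List ℤ} {M : ℕ} {s s' : ℕ × List ℕ} :
    s' ∈ searchStep A w M s ↔ s' = s ∨
      (A.InvHolds (Truth w (trunc M (tickClocks (clockVal s.2)))) s.1 ∧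
        s' = (s.1, trunc M (tickClocks (clockVal s.2)))) ∨
      ∃ t ∈ A.edges, t.src = s.1 ∧ (∀ c ∈ t.guard, Truth w s.2 c) ∧
        A.InvHolds (Truth w (trunc M (applyUpdate (clockVal s.2) t.upd))) t.tgt ∧
        s' = (t.tgt, trunc M (applyUpdate (clockVal s.2) t.upd)) := by
  simp only [searchStep, List.mem_cons, List.mem_map]
  constructor
  · rintro (h | h | ⟨t, ht, rfl⟩)
    · exact .inl h
    · split_ifs at h with hc
      · exact .inr (.inl ⟨hc, h⟩)
      · exact .inl h
    · split_ifs with hc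
      · exact .inr (.inr ⟨t, ht, hc.1, hc.2.1, hc.2.2, rfl⟩)
      · exact .inl rfl
  · rintro (h | ⟨hc, h⟩ | ⟨t, ht, h1, h2, h3, rfl⟩)
    · exact .inl h
    · exact .inr (.inl (by rw [if_pos hc]; exact h))
    · exact .inr (.inr ⟨t, ht, by rw [if_pos ⟨h1, h2, h3⟩]⟩)

theorem search_succ (A : PTA) (w : List ℤ) (M n : ℕ) :
    search A w M (n + 1) = (search A w M n).flatMap (searchStep A w M) := by
  rw [search, Function.iterate_succ_apply']
  rfl

section

variable {A : PTA} {φ : StateProp} {K M : ℕ} {w : List ℤ}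

theorem truth_iff (hb : BoundedBy A φ K) (hM : K ≤ M) (hw : ∀ i < K, |listVal w i| < M)
    {c : AtomicConstraint} (hc : Occurs A φ c) {l : List ℕ} {ω : ClockVal}
    (h : absVal M (clockVal l) = absVal M ω) : Truth w l c ↔ c.HoldsV (listVal w) ω :=
  holdsV_congr_abs (fun y hy => (hb.clock c hc y hy).trans_le hM)
    (fun e he => hw _ (hb.expr c hc e he)) h

theorem absVal_trunc (M : ℕ) (ω : ClockVal) : absVal M (clockVal (trunc M ω)) = absVal M ω :=
  absVal_congr fun _ hy => clockVal_trunc hy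

theorem trunc_tick (M : ℕ) (ω : ClockVal) :
    trunc M (tickClocks (clockVal (trunc M ω))) = trunc M (tickClocks ω) :=
  trunc_congr fun y hy => by simp only [tickClocks, clockVal_trunc hy]

theorem trunc_update (M : ℕ) (ω : ClockVal) (u : UpdateSet) :
    trunc M (applyUpdate (clockVal (trunc M ω)) u) = trunc M (applyUpdate ω u) :=
  trunc_congr fun y hy => by simp only [applyUpdate, clockVal_trunc hy]

theorem exists_uReach_of_mem_search (hb : BoundedBy A φ K) (hM : K ≤ M)
    (hw : ∀ i < K, |listVal w i| < M) {n : ℕ} {s : ℕ × List ℕ} (h : s ∈ search A w M n) :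
    ∃ ω, s.2 = trunc M ω ∧ UReach A (fun ω c => c.HoldsV (listVal w) ω) s.1 ω := by
  have ht := fun {c} hc {ω} => truth_iff (c := c) hb hM hw hc (absVal_trunc M ω)
  have hinv : ∀ {ω q}, A.InvHolds (Truth w (trunc M ω)) q →
      A.InvHolds (fun c => c.HoldsV (listVal w) ω) q := fun h =>
    (PTA.invHolds_congr fun c hc => ht (.inl hc)).1 h
  induction n generalizing s with
  | zero =>
    simp only [search, Function.iterate_zero, id, searchInit] at h
    split_ifs at h with hi
    · simp only [List.mem_singleton] at h
      subst h
      exact ⟨fun _ => 0, rfl, .init (hinv hi)⟩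
    · simp at h
  | succ n ih =>
    rw [search_succ, List.mem_flatMap] at h
    obtain ⟨⟨q, l⟩, hs, h⟩ := h
    obtain ⟨ω, hl, hr⟩ := ih hs
    simp only at hl hr
    subst hl
    rw [mem_searchStep] at h
    simp only [trunc_tick, trunc_update] at h
    rcases h with rfl | ⟨hi, rfl⟩ | ⟨t, he, rfl, hg, hi, rfl⟩
    · exact ⟨ω, rfl, hr⟩
    · exact ⟨_, rfl, hr.tick (hinv hi)⟩
    · exact ⟨_, rfl, hr.edge he (fun c hc => (ht (.inl (.inr ⟨t, he, hc⟩))).1 (hg c hc)) (hinv hi)⟩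

theorem UReach.exists_mem_search (hb : BoundedBy A φ K) (hM : K ≤ M)
    (hw : ∀ i < K, |listVal w i| < M) {q : ℕ} {ω : ClockVal}
    (h : UReach A (fun ω c => c.HoldsV (listVal w) ω) q ω) :
    ∃ n, (q, trunc M ω) ∈ search A w M n := by
  have ht := fun {c} hc {ω} => truth_iff (c := c) hb hM hw hc (absVal_trunc M ω)
  have hinv : ∀ {ω q}, A.InvHolds (fun c => c.HoldsV (listVal w) ω) q →
      A.InvHolds (Truth w (trunc M ω)) q := fun h =>
    (PTA.invHolds_congr fun c hc => ht (.inl hc)).2 h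
  induction h with
  | init hi =>
    exact ⟨0, by simp [search, searchInit, if_pos (hinv hi)]⟩
  | tick _ hi ih =>
    obtain ⟨n, hn⟩ := ih
    refine ⟨n + 1, ?_⟩
    rw [search_succ, List.mem_flatMap]
    refine ⟨_, hn, mem_searchStep.2 (.inr (.inl ?_))⟩
    simp only [trunc_tick, and_true]
    exact hinv hi
  | @edge ω t _ he hg hi ih =>
    obtain ⟨n, hn⟩ := ih
    refine ⟨n + 1, ?_⟩
    rw [search_succ, List.mem_flatMap]
    refine ⟨_, hn, mem_searchStep.2 (.inr (.inr ⟨t, he, rfl, ?_⟩))⟩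
    simp only [trunc_update, and_true]
    exact ⟨fun c hc => (ht (.inl (.inr ⟨t, he, hc⟩))).2 (hg c hc), hinv hi⟩

/-- The abstraction of a configuration. -/
def absConf (M : ℕ) (s : ℕ × List ℕ) : AbsState M := absState M s.1 (clockVal s.2)

theorem searchStep_bisim (hb : BoundedBy A φ K) (hM : K ≤ M) (hw : ∀ i < K, |listVal w i| < M)
    {s s₁ s' : ℕ × List ℕ} (hs : s.1 ≤ M) (hs₁ : s₁.1 ≤ M) (h : absConf M s = absConf M s₁)
    (hs' : s' ∈ searchStep A w M s) : ∃ s'' ∈ searchStep A w M s₁, absConf M s' = absConf M s'' := by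
  obtain ⟨q, l⟩ := s
  obtain ⟨q₁, l₁⟩ := s₁
  obtain ⟨hq, hl⟩ := absState_inj hs hs₁ h
  simp only at hq hl
  subst hq
  have ht : ∀ {c l l₁}, absVal M (clockVal l) = absVal M (clockVal l₁) → Occurs A φ c →
    (Truth w l c ↔ Truth w l₁ c) := fun h hc => truth_iff hb hM hw hc h
  have hinv : ∀ {ω ω₁ q}, absVal M ω = absVal M ω₁ → A.InvHolds (Truth w (trunc M ω)) q →
      A.InvHolds (Truth w (trunc M ω₁)) q := fun h =>
    (PTA.invHolds_congr fun c hc => ht (by rw [absVal_trunc, absVal_trunc, h]) (.inl hc)).1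
  rw [mem_searchStep] at hs'
  rcases hs' with rfl | ⟨hi, rfl⟩ | ⟨t, he, rfl, hg, hi, rfl⟩
  · exact ⟨_, mem_searchStep.2 (.inl rfl), h⟩
  · have := absVal_tick hl
    refine ⟨_, mem_searchStep.2 (.inr (.inl ⟨hinv this hi, rfl⟩)), ?_⟩
    simp only [absConf, absState, absVal_trunc, this]
  · have := absVal_update (u := t.upd) (fun r hr => ((hb.upd t he r hr).2).trans_le hM) hl
    refine ⟨_, mem_searchStep.2 (.inr (.inr ⟨t, he, rfl, ?_, hinv this hi, rfl⟩)), ?_⟩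
    · exact fun c hc => (ht hl (.inl (.inr ⟨t, he, hc⟩))).1 (hg c hc)
    · simp only [absConf, absState, absVal_trunc, this]

/-- The search itself uses exact clock values, which are unbounded. Its abstraction, however, is the
orbit of an inflationary map on sets of abstract states, by `searchStep_bisim`, and so is complete
after `setBound M` rounds. -/
theorem exists_mem_search_bound (hb : BoundedBy A φ K) (hM : K ≤ M)
    (hw : ∀ i < K, |listVal w i| < M) {n : ℕ} {s : ℕ × List ℕ} (h : s ∈ search A w M n) :
    ∃ s' ∈ search A w M (setBound M), absConf M s = absConf M s' := by
  have hle : ∀ {n s}, s ∈ search A w M n → s.1 ≤ M := fun h => by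
    obtain ⟨ω, -, hr⟩ := exists_uReach_of_mem_search hb hM hw h
    exact (hr.inv.lt.trans_le (hb.loc.trans hM)).le
  let f : Set (AbsState M) → Set (AbsState M) := fun U =>
    U ∪ {σ | ∃ s s', s.1 ≤ M ∧ absConf M s ∈ U ∧ s' ∈ searchStep A w M s ∧ σ = absConf M s'}
  have hf : ∀ n, f^[n] {σ | ∃ s ∈ searchInit A w M, σ = absConf M s} =
      {σ | ∃ s ∈ search A w M n, σ = absConf M s} := by
    intro n
    induction n with
    | zero => rfl
    | succ n ih =>
      rw [Function.iterate_succ_apply', ih]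
      ext σ
      rw [search_succ]
      simp only [f, Set.mem_union, Set.mem_ofPred_eq, List.mem_flatMap]
      constructor
      · rintro (⟨s, hs, rfl⟩ | ⟨s, s', hs, ⟨s₁, hs₁, he⟩, hs', rfl⟩)
        · exact ⟨s, ⟨s, hs, mem_searchStep.2 (.inl rfl)⟩, rfl⟩
        · obtain ⟨s'', h1, h2⟩ := searchStep_bisim hb hM hw hs (hle hs₁) he hs'
          exact ⟨s'', ⟨s₁, hs₁, h1⟩, h2⟩
      · rintro ⟨s', ⟨s, hs, hs'⟩, rfl⟩
        exact .inr ⟨s, s', hle hs, ⟨s, hs, rfl⟩, hs', rfl⟩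
  have := iterate_subset_of_inflationary f (fun U => Set.subset_union_left)
    (two_pow_card_absState M).le {σ | ∃ s ∈ searchInit A w M, σ = absConf M s} n
  rw [hf, hf] at this
  exact this ⟨s, h, rfl⟩

/-- Safety for a fixed valuation is decided by a bounded search. -/
theorem unsafe_iff_search (hb : BoundedBy A φ K) (hM : K ≤ M) (hw : ∀ i < K, |listVal w i| < M) :
    Unsafe A φ (fun ω c => c.HoldsV (listVal w) ω) ↔
      ∃ s ∈ search A w M (setBound M), ¬ φ.Eval (Truth w s.2) s.1 := by
  constructor
  · rintro ⟨q, ω, hr, hbad⟩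
    obtain ⟨n, hn⟩ := hr.exists_mem_search hb hM hw
    obtain ⟨s, hs, he⟩ := exists_mem_search_bound hb hM hw hn
    obtain ⟨ω', hl, hr'⟩ := exists_uReach_of_mem_search hb hM hw hs
    obtain ⟨q', l⟩ := s
    obtain ⟨rfl, hω⟩ := absState_inj (hr.inv.lt.trans_le (hb.loc.trans hM)).le
      (hr'.inv.lt.trans_le (hb.loc.trans hM)).le he
    refine ⟨_, hs, ?_⟩
    rwa [StateProp.eval_congr fun c hc => truth_iff hb hM hw (.inr hc)
      (hω.symm.trans (absVal_trunc M ω))]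
  · rintro ⟨s, hs, hbad⟩
    obtain ⟨ω, hl, hr⟩ := exists_uReach_of_mem_search hb hM hw hs
    refine ⟨_, ω, hr, ?_⟩
    rwa [hl, StateProp.eval_congr fun c hc => truth_iff hb hM hw (.inr hc) (absVal_trunc M ω)]
      at hbad

end

/-! ### The output systems and correctness of the synthesis -/

/-- All lists of `n` integers from `[-B, B]`. -/
def box (B n : ℕ) : List (List ℤ) :=
  (fun L : List (List ℤ) => L.flatMap fun l =>
    (List.range (2 * B + 1)).map fun r : ℕ => ((r : ℤ) - (B : ℤ)) :: l)^[n] [[]]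

theorem mem_box {B n : ℕ} {l : List ℤ} : l ∈ box B n ↔ l.length = n ∧ ∀ z ∈ l, |z| ≤ B := by
  induction n generalizing l with
  | zero => simp +contextual [box]
  | succ n ih =>
    rw [box, Function.iterate_succ_apply', ← box]
    simp only [List.mem_flatMap, List.mem_map, List.mem_range, ih]
    constructor
    · rintro ⟨l, ⟨rfl, h⟩, r, hr, rfl⟩
      simp only [List.length_cons, List.mem_cons, forall_eq_or_imp, true_and]
      exact ⟨abs_le.2 (by omega), h⟩
    · rintro ⟨hl, h⟩
      obtain _ | ⟨z, l⟩ := l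
      · simp at hl
      simp only [List.mem_cons, forall_eq_or_imp] at h
      have := abs_le.1 h.1
      exact ⟨l, ⟨by simpa using hl, h.2⟩, (z + B).toNat, by omega, by congr 1; omega⟩

def LinExpr.comb (e : LinExpr) (s : ℤ) (f : LinExpr) : LinExpr :=
  ⟨e.const + s * f.const, e.terms ++ f.terms.map fun t => (t.1, s * t.2)⟩

def LinExpr.addConst (e : LinExpr) (d : ℤ) : LinExpr := ⟨e.const + d, e.terms⟩

theorem LinExpr.eval_comb (e f : LinExpr) (s : ℤ) (γ : ParamVal) :
    (e.comb s f).eval γ = e.eval γ + s * f.eval γ := by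
  have h : ∀ l : List (ℕ × ℤ), (l.map fun t => s * t.2 * γ t.1).sum =
      s * (l.map fun t => t.2 * γ t.1).sum := by
    intro l
    induction l with
    | nil => simp
    | cons t l ih => simp only [List.map_cons, List.sum_cons, ih]; ring
  simp only [LinExpr.eval, LinExpr.comb, List.map_append, List.sum_append, List.map_map,
    Function.comp_def, h]
  ring

theorem LinExpr.eval_addConst (e : LinExpr) (d : ℤ) (γ : ParamVal) :
    (e.addConst d).eval γ = e.eval γ + d := by
  simp only [LinExpr.eval, LinExpr.addConst]
  ring

/-- The condition that the value of `e` and the number `d` agree after truncation at `±N`. -/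
def clampCondition (N d : ℤ) (e : LinExpr) : ParamCondition :=
  if N ≤ d then .nonneg (e.addConst (-N))
  else if d ≤ -N then .nonneg ((LinExpr.comb ⟨-N, []⟩ (-1) e))
  else .zero (e.addConst (-d))

theorem clampCondition_holds {N d : ℤ} (hN : 0 < N) {e : LinExpr} {γ : ParamVal} :
    (clampCondition N d e).Holds γ ↔ ClampEq N (e.eval γ) d := by
  unfold clampCondition ClampEq
  split_ifs
  · simp only [ParamCondition.Holds, LinExpr.eval_addConst]; omega
  · simp only [ParamCondition.Holds, LinExpr.eval_comb]
    simp only [LinExpr.eval, List.map_nil, List.sum_nil]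
    omega
  · simp only [ParamCondition.Holds, LinExpr.eval_addConst]; omega

/-- The system of conditions that describes similarity with `w`. -/
def similarSystem (K N k : ℕ) (w : List ℤ) : ParamSystem :=
  (List.range K).flatMap fun i =>
    .cong k ((Denumerable.ofNat LinExpr i).addConst (-listVal w i)) ::
    (List.range K).flatMap fun j =>
      [clampCondition N (listVal w i) (Denumerable.ofNat LinExpr i),
       clampCondition N (listVal w i + (-1) * listVal w j)
        ((Denumerable.ofNat LinExpr i).comb (-1) (Denumerable.ofNat LinExpr j)),
       clampCondition N (listVal w i + 1 * listVal w j)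
        ((Denumerable.ofNat LinExpr i).comb 1 (Denumerable.ofNat LinExpr j))]

theorem similarSystem_holds {K N k : ℕ} {w : List ℤ} {γ : ParamVal} (hN : 0 < N) :
    (∀ c ∈ similarSystem K N k w, c.Holds γ) ↔ SimilarVal K N k (exprVal γ) (listVal w) := by
  have hN' : (0 : ℤ) < N := by exact_mod_cast hN
  have key : (∀ c ∈ similarSystem K N k w, c.Holds γ) ↔ ∀ i < K,
      ((k : ℤ) ∣ exprVal γ i - listVal w i) ∧ ∀ j < K,
        ClampEq N (exprVal γ i) (listVal w i) ∧
        ClampEq N (exprVal γ i - exprVal γ j) (listVal w i - listVal w j) ∧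
        ClampEq N (exprVal γ i + exprVal γ j) (listVal w i + listVal w j) := by
    simp only [similarSystem, List.mem_flatMap, List.mem_range, List.mem_cons, List.not_mem_nil,
      or_false]
    constructor
    · intro h i hi
      refine ⟨?_, fun j hj => ⟨?_, ?_, ?_⟩⟩
      · have := h _ ⟨i, hi, .inl rfl⟩
        simpa [ParamCondition.Holds, LinExpr.eval_addConst, sub_eq_add_neg, exprVal] using this
      · exact (clampCondition_holds hN').1 (h _ ⟨i, hi, .inr ⟨j, hj, .inl rfl⟩⟩)
      · have := (clampCondition_holds hN').1 (h _ ⟨i, hi, .inr ⟨j, hj, .inr (.inl rfl)⟩⟩)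
        rwa [LinExpr.eval_comb, neg_one_mul, neg_one_mul, ← sub_eq_add_neg, ← sub_eq_add_neg] at this
      · have := (clampCondition_holds hN').1 (h _ ⟨i, hi, .inr ⟨j, hj, .inr (.inr rfl)⟩⟩)
        rwa [LinExpr.eval_comb, one_mul, one_mul] at this
    · rintro h c ⟨i, hi, rfl | ⟨j, hj, rfl | rfl | rfl⟩⟩
      · have := (h i hi).1
        simpa [ParamCondition.Holds, LinExpr.eval_addConst, sub_eq_add_neg, exprVal] using this
      · exact (clampCondition_holds hN').2 ((h i hi).2 j hj).1
      · rw [clampCondition_holds hN', LinExpr.eval_comb, neg_one_mul, neg_one_mul,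
          ← sub_eq_add_neg, ← sub_eq_add_neg]
        exact ((h i hi).2 j hj).2.1
      · rw [clampCondition_holds hN', LinExpr.eval_comb, one_mul, one_mul]
        exact ((h i hi).2 j hj).2.2
  rw [key]
  constructor
  · intro h
    -- The condition on a single entry sits in the inner loop and is recovered at `j = i`.
    exact ⟨fun i hi => ((h i hi).2 i hi).1, fun i hi j hj => ((h i hi).2 j hj).2.1,
      fun i hi j hj => ((h i hi).2 j hj).2.2, fun i hi => (h i hi).1⟩
  · intro h i hi
    exact ⟨h.mod i hi, fun j hj => ⟨h.self i hi, h.sub i hi j hj, h.add i hi j hj⟩⟩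

/-- A bound for the entries of reduced valuations. -/
def entryBound (K : ℕ) : ℕ := (threshold K + period K) * (K + 1)

/-- A bound for clocks, locations and all constants, including the values of expressions. -/
def clockBound (K : ℕ) : ℕ := K + entryBound K + 1

open Classical in
/-- The synthesis algorithm, for a bound `K` of the numerical data. -/
noncomputable def synthBounded (A : PTA) (φ : StateProp) (K : ℕ) : List ParamSystem :=
  (box (entryBound K) K).flatMap fun w =>
    if ∃ s ∈ search A w (clockBound K) (setBound (clockBound K)), ¬ φ.Eval (Truth w s.2) s.1 then []
    else [similarSystem K (threshold K) (period K) w]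

theorem solutionSet_synthBounded {A : PTA} {φ : StateProp} {K x : ℕ} (hb : BoundedBy A φ K)
    (hx : ∀ y, IsParametricClock A φ y → y = x) :
    solutionSet (synthBounded A φ K) = A.feasible (.always φ) := by
  have hN : 0 < threshold K := by unfold threshold; omega
  have hbox : ∀ w ∈ box (entryBound K) K, ∀ i < K, |listVal w i| < clockBound K := by
    intro w hw i hi
    rw [mem_box] at hw
    have h1 : i < w.length := by omega
    have := hw.2 _ (List.getElem_mem h1)
    rw [listVal, List.getD_eq_getElem _ _ h1]
    unfold clockBound
    push_cast
    omega
  ext γ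
  rw [PTA.mem_feasible_iff]
  simp only [solutionSet, Set.mem_ofPred_eq, synthBounded, List.mem_flatMap]
  constructor
  · rintro ⟨S, ⟨w, hw, hS⟩, h⟩
    split_ifs at hS with hc
    · simp at hS
    · rw [List.mem_singleton] at hS
      subst hS
      rw [similarSystem_holds hN] at h
      -- A list in the box need not consist of the values of expressions at any `γ`. Only lists
      -- similar to some `exprVal γ` contribute solutions, and for these safety transfers.
      rw [unsafe_iff_of_similar hb hx (genuine_exprVal K γ) h,
        unsafe_iff_search hb (by unfold clockBound; omega) (hbox w hw)]
      exact hc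
  · intro h
    -- The list in the box that covers `γ` is the reduced form of its expression values.
    obtain ⟨v, hv, hr, hs, hi⟩ := exists_reduced hb hx (genuine_exprVal K γ)
    have hvw : ∀ i < K, listVal ((List.range K).map v) i = v i := by
      intro i hi
      simp [listVal, List.getD, hi]
    have hw : (List.range K).map v ∈ box (entryBound K) K := by
      rw [mem_box]
      refine ⟨by simp, fun z hz => ?_⟩
      simp only [List.mem_map, List.mem_range] at hz
      obtain ⟨i, hi, rfl⟩ := hz
      have := hr.abs_lt (by positivity) i hi
      unfold entryBound
      push_cast
      exact this.le
    have hsim : SimilarVal K (threshold K) (period K) (exprVal γ)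
        (listVal ((List.range K).map v)) := by
      refine ⟨fun i hi => ?_, fun i hi j hj => ?_, fun i hi j hj => ?_, fun i hi => ?_⟩
      · rw [hvw i hi]; exact hs.self i hi
      · rw [hvw i hi, hvw j hj]; exact hs.sub i hi j hj
      · rw [hvw i hi, hvw j hj]; exact hs.add i hi j hj
      · rw [hvw i hi]; exact hs.mod i hi
    rw [unsafe_iff_of_similar hb hx (genuine_exprVal K γ) hsim,
      unsafe_iff_search hb (by unfold clockBound; omega) (hbox _ hw)] at h
    refine ⟨_, ⟨_, hw, ?_⟩, (similarSystem_holds hN).2 hsim⟩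
    rw [if_neg h]
    exact List.mem_singleton.2 rfl

/-! ### Codes bound all numerical data -/

section Bounds

theorem encode_lt_of_mem {α : Type*} [Encodable α] {a : α} {l : List α} (h : a ∈ l) :
    encode a < encode l := by
  induction l with
  | nil => simp at h
  | cons b l ih =>
    rw [encode_list_cons, Nat.lt_succ_iff]
    rcases List.mem_cons.1 h with rfl | h
    · exact Nat.left_le_pair _ _
    · exact (ih h).le.trans (Nat.right_le_pair _ _)

theorem AtomicConstraint.encode_le (c : AtomicConstraint) :
    encode c.lhs ≤ encode c ∧ encode c.rhs ≤ encode c := by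
  have h1 := Nat.left_le_pair (encode c.lhs) (encode c.rhs)
  have h2 := Nat.right_le_pair (encode c.lhs) (encode c.rhs)
  have h3 : Nat.pair (encode c.lhs) (encode c.rhs) ≤ encode c := by
    obtain ⟨l, _ | _ | _, r⟩ := c
    · change _ ≤ 2 * (2 * Nat.pair (encode l) (encode r)); simp only; omega
    · change _ ≤ 2 * (2 * Nat.pair (encode l) (encode r) + 1); simp only; omega
    · change _ ≤ 2 * Nat.pair (encode l) (encode r) + 1; simp only; omega
  omega

theorem ClockTerm.le_encode {t : ClockTerm} {y : ℕ} (h : t.Mentions y) : y ≤ encode t := by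
  cases t with
  | pos x =>
    obtain rfl : y = x := h
    change y ≤ 2 * (2 * y); omega
  | neg x =>
    obtain rfl : y = x := h
    change y ≤ 2 * (2 * y + 1); omega
  | diff x z =>
    have h1 := Nat.left_le_pair x z
    have h2 := Nat.right_le_pair x z
    change y ≤ 2 * Nat.pair x z + 1
    rcases h with rfl | rfl <;> omega

theorem StateProp.encode_le {c : AtomicConstraint} {φ : StateProp} (h : φ.HasConstraint c) :
    encode c ≤ encode φ := by
  change _ ≤ φ.toNat
  induction φ with
  | atom c' => obtain rfl : c = c' := h; simp only [StateProp.toNat]; omega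
  | loc q => exact h.elim
  | not φ ih => have := ih h; simp only [StateProp.toNat]; omega
  | and φ₁ φ₂ ih₁ ih₂ =>
    have h1 := Nat.left_le_pair φ₁.toNat φ₂.toNat
    have h2 := Nat.right_le_pair φ₁.toNat φ₂.toNat
    simp only [StateProp.toNat]
    rcases h with h | h
    · have := ih₁ h; omega
    · have := ih₂ h; omega
  | or φ₁ φ₂ ih₁ ih₂ =>
    have h1 := Nat.left_le_pair φ₁.toNat φ₂.toNat
    have h2 := Nat.right_le_pair φ₁.toNat φ₂.toNat
    simp only [StateProp.toNat]
    rcases h with h | h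
    · have := ih₁ h; omega
    · have := ih₂ h; omega

theorem PTA.encode_le (A : PTA) : encode A.inv ≤ encode A ∧ encode A.edges ≤ encode A := by
  have h1 : encode A = Nat.pair (encode A.actions)
    (Nat.pair (encode A.inv) (Nat.pair A.init (encode A.edges))) := rfl
  have h2 := Nat.right_le_pair (encode A.actions)
    (Nat.pair (encode A.inv) (Nat.pair A.init (encode A.edges)))
  have h3 := Nat.left_le_pair (encode A.inv) (Nat.pair A.init (encode A.edges))
  have h4 := Nat.right_le_pair (encode A.inv) (Nat.pair A.init (encode A.edges))
  have h5 := Nat.right_le_pair A.init (encode A.edges)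
  omega

theorem Edge.encode_le (t : Edge) : encode t.guard ≤ encode t ∧ encode t.upd ≤ encode t := by
  have h1 : encode t = Nat.pair t.src (Nat.pair (encode t.guard)
    (Nat.pair t.act (Nat.pair (encode t.upd) t.tgt))) := rfl
  have h2 := Nat.right_le_pair t.src (Nat.pair (encode t.guard)
    (Nat.pair t.act (Nat.pair (encode t.upd) t.tgt)))
  have h3 := Nat.left_le_pair (encode t.guard) (Nat.pair t.act (Nat.pair (encode t.upd) t.tgt))
  have h4 := Nat.right_le_pair (encode t.guard) (Nat.pair t.act (Nat.pair (encode t.upd) t.tgt))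
  have h5 := Nat.right_le_pair t.act (Nat.pair (encode t.upd) t.tgt)
  have h6 := Nat.left_le_pair (encode t.upd) t.tgt
  omega

/-- Pairing dominates its components, so the code of an object is at least the code of each part;
this yields a computable `K` without inspecting the automaton. -/
theorem boundedBy_encode (A : PTA) (φ : StateProp) : BoundedBy A φ (encode (A, φ) + 1) := by
  have h0 : encode (A, φ) = Nat.pair (encode A) (encode φ) := rfl
  have h1 := Nat.left_le_pair (encode A) (encode φ)
  have h2 := Nat.right_le_pair (encode A) (encode φ)
  have hA := A.encode_le
  have hc : ∀ c, A.HasConstraint c ∨ φ.HasConstraint c → encode c ≤ encode (A, φ) := by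
    rintro c ((⟨g, hg, hc⟩ | ⟨t, ht, hc⟩) | hc)
    · have := encode_lt_of_mem hg
      have := encode_lt_of_mem hc
      omega
    · have := encode_lt_of_mem ht
      have := encode_lt_of_mem hc
      have := t.encode_le
      omega
    · have := StateProp.encode_le hc
      omega
  refine ⟨?_, fun t ht r hr => ?_, fun c h y hy => ?_, fun c h e he => ?_⟩
  · have := length_le_encode A.inv
    omega
  · have := encode_lt_of_mem ht
    have := encode_lt_of_mem hr
    have := t.encode_le
    have h3 : encode r = Nat.pair r.1 r.2 := rfl
    have := Nat.left_le_pair r.1 r.2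
    have := Nat.right_le_pair r.1 r.2
    omega
  · have := hc c h
    have := c.encode_le
    have := ClockTerm.le_encode hy
    omega
  · have := hc c h
    have h3 := c.encode_le.2
    rw [he] at h3
    have h4 : encode (Expression.lin e) = Nat.succ (encode e) := rfl
    omega

end Bounds

/-! ### Primitive recursive integer arithmetic -/

section Int

theorem primrec_intCast : Primrec (fun n : ℕ => (n : ℤ)) :=
  Primrec.encode_iff.1 (Primrec.nat_double.of_eq fun _ => rfl)

theorem primrec_negSucc : Primrec Int.negSucc :=
  Primrec.encode_iff.1 (Primrec.nat_double_succ.of_eq fun _ => rfl)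

/-- The code of an integer is `2 * n` for `n` and `2 * n + 1` for `-(n + 1)`, so positive and
negative parts can be read off; arithmetic and order then reduce to natural numbers. -/
theorem primrec_toNat : Primrec Int.toNat := by
  refine (Primrec.ite (c := fun z : ℤ => encode z % 2 = 0) (f := fun z => encode z / 2)
    (g := fun _ => 0) ?_ ?_ ?_).of_eq ?_
  · exact Primrec.eq.comp (Primrec.nat_mod.comp Primrec.encode (Primrec.const 2)) (Primrec.const 0)
  · exact Primrec.nat_div.comp Primrec.encode (Primrec.const 2)
  · exact Primrec.const 0
  · rintro (n | n)
    · have : encode (Int.ofNat n) = 2 * n := rfl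
      rw [this]; simp
    · have : encode (Int.negSucc n) = 2 * n + 1 := rfl
      rw [this, if_neg (by omega)]; rfl

theorem primrec_toNat_neg : Primrec (fun z : ℤ => (-z).toNat) := by
  refine (Primrec.ite (c := fun z : ℤ => encode z % 2 = 0) (f := fun _ => 0)
    (g := fun z => encode z / 2 + 1) ?_ ?_ ?_).of_eq ?_
  · exact Primrec.eq.comp (Primrec.nat_mod.comp Primrec.encode (Primrec.const 2)) (Primrec.const 0)
  · exact Primrec.const 0
  · exact Primrec.succ.comp (Primrec.nat_div.comp Primrec.encode (Primrec.const 2))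
  · rintro (n | n)
    · have : encode (Int.ofNat n) = 2 * n := rfl
      rw [this, if_pos (by omega)]; simp
    · have : encode (Int.negSucc n) = 2 * n + 1 := rfl
      rw [this, if_neg (by omega)]; simp; omega

theorem primrec_natSub : Primrec₂ (fun a b : ℕ => (a : ℤ) - b) := by
  have : Primrec (fun p : ℕ × ℕ =>
      if p.2 ≤ p.1 then ((p.1 - p.2 : ℕ) : ℤ) else Int.negSucc (p.2 - p.1 - 1)) :=
    Primrec.ite (Primrec.nat_le.comp Primrec.snd Primrec.fst)
      (primrec_intCast.comp (Primrec.nat_sub.comp Primrec.fst Primrec.snd))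
      (primrec_negSucc.comp (Primrec.nat_sub.comp (Primrec.nat_sub.comp Primrec.snd Primrec.fst)
        (Primrec.const 1)))
  refine this.of_eq fun p => ?_
  change _ = (p.1 : ℤ) - p.2
  split_ifs
  · omega
  · rw [Int.negSucc_eq]; omega

variable {α : Type*} [Primcodable α] {f g : α → ℤ}

theorem primrec_intAdd (hf : Primrec f) (hg : Primrec g) : Primrec fun a => f a + g a :=
  (primrec_natSub.comp
    (Primrec.nat_add.comp (primrec_toNat.comp hf) (primrec_toNat.comp hg))
    (Primrec.nat_add.comp (primrec_toNat_neg.comp hf) (primrec_toNat_neg.comp hg))).of_eq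
    fun a => by push_cast; omega

theorem primrec_intNeg (hf : Primrec f) : Primrec fun a => - f a :=
  (primrec_natSub.comp (primrec_toNat_neg.comp hf) (primrec_toNat.comp hf)).of_eq
    fun a => by omega

theorem primrec_intSub (hf : Primrec f) (hg : Primrec g) : Primrec fun a => f a - g a :=
  (primrec_intAdd hf (primrec_intNeg hg)).of_eq fun _ => (sub_eq_add_neg _ _).symm

theorem primrec_intMul (hf : Primrec f) (hg : Primrec g) : Primrec fun a => f a * g a := by
  refine (primrec_natSub.comp
    (Primrec.nat_add.comp (Primrec.nat_mul.comp (primrec_toNat.comp hf) (primrec_toNat.comp hg))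
      (Primrec.nat_mul.comp (primrec_toNat_neg.comp hf) (primrec_toNat_neg.comp hg)))
    (Primrec.nat_add.comp (Primrec.nat_mul.comp (primrec_toNat.comp hf) (primrec_toNat_neg.comp hg))
      (Primrec.nat_mul.comp (primrec_toNat_neg.comp hf) (primrec_toNat.comp hg)))).of_eq fun a => ?_
  have h1 : f a = ((f a).toNat : ℤ) - ((-f a).toNat : ℤ) := by omega
  have h2 : g a = ((g a).toNat : ℤ) - ((-g a).toNat : ℤ) := by omega
  conv_rhs => rw [h1, h2]
  push_cast
  ring

theorem primrecPred_intLe (hf : Primrec f) (hg : Primrec g) : PrimrecPred fun a => f a ≤ g a :=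
  (Primrec.nat_le.comp
    (Primrec.nat_add.comp (primrec_toNat.comp hf) (primrec_toNat_neg.comp hg))
    (Primrec.nat_add.comp (primrec_toNat.comp hg) (primrec_toNat_neg.comp hf))).of_eq
    fun a => by omega

theorem primrecPred_intLt (hf : Primrec f) (hg : Primrec g) : PrimrecPred fun a => f a < g a :=
  (primrecPred_intLe hg hf).not.of_eq fun _ => not_le

end Int

/-! ### Primitive recursive access to the syntax -/

section Structures

/-- The codings of the structures are transported along the equivalences, so the equivalences act as
the identity on codes. -/
theorem primrec_of_encode_eq {α β : Type*} [Primcodable α] [Primcodable β] {f : α → β}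
    (h : ∀ a, encode (f a) = encode a) : Primrec f :=
  Primrec.encode_iff.1 (Primrec.encode.of_eq fun a => (h a).symm)

theorem primrec_linExprEquiv : Primrec LinExpr.equiv := primrec_of_encode_eq fun _ => rfl
theorem primrec_expressionEquiv : Primrec Expression.equiv := primrec_of_encode_eq fun _ => rfl
theorem primrec_clockTermEquiv : Primrec ClockTerm.equiv := primrec_of_encode_eq fun _ => rfl
theorem primrec_constraintEquiv : Primrec AtomicConstraint.equiv :=
  primrec_of_encode_eq fun _ => rfl
theorem primrec_edgeEquiv : Primrec Edge.equiv := primrec_of_encode_eq fun _ => rfl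
theorem primrec_ptaEquiv : Primrec PTA.equiv := primrec_of_encode_eq fun _ => rfl

theorem primrec_linExprMk : Primrec LinExpr.equiv.symm := primrec_of_encode_eq fun _ => rfl
theorem primrec_conditionMk : Primrec ParamCondition.equiv.symm :=
  primrec_of_encode_eq fun a => by rcases a with (e | e) | e <;> rfl

theorem primrec_const : Primrec LinExpr.const := Primrec.fst.comp primrec_linExprEquiv
theorem primrec_terms : Primrec LinExpr.terms := Primrec.snd.comp primrec_linExprEquiv
theorem primrec_src : Primrec Edge.src := Primrec.fst.comp primrec_edgeEquiv
theorem primrec_guard : Primrec Edge.guard :=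
  Primrec.fst.comp (Primrec.snd.comp primrec_edgeEquiv)
theorem primrec_upd : Primrec Edge.upd :=
  Primrec.fst.comp (Primrec.snd.comp (Primrec.snd.comp (Primrec.snd.comp primrec_edgeEquiv)))
theorem primrec_tgt : Primrec Edge.tgt :=
  Primrec.snd.comp (Primrec.snd.comp (Primrec.snd.comp (Primrec.snd.comp primrec_edgeEquiv)))
theorem primrec_inv : Primrec PTA.inv := Primrec.fst.comp (Primrec.snd.comp primrec_ptaEquiv)
theorem primrec_init : Primrec PTA.init :=
  Primrec.fst.comp (Primrec.snd.comp (Primrec.snd.comp primrec_ptaEquiv))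
theorem primrec_edges : Primrec PTA.edges :=
  Primrec.snd.comp (Primrec.snd.comp (Primrec.snd.comp primrec_ptaEquiv))

theorem primrec_nonneg : Primrec ParamCondition.nonneg :=
  primrec_conditionMk.comp (Primrec.sumInl.comp Primrec.sumInl)
theorem primrec_zero : Primrec ParamCondition.zero :=
  primrec_conditionMk.comp (Primrec.sumInl.comp Primrec.sumInr)
theorem primrec_cong : Primrec₂ ParamCondition.cong :=
  primrec_conditionMk.comp Primrec.sumInr

end Structures

/-! ### Primitive recursive evaluation of constraints and state properties -/

section Semantics

variable {α : Type*} [Primcodable α]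

theorem primrec_listVal {w : α → List ℤ} {n : α → ℕ} (hw : Primrec w) (hn : Primrec n) :
    Primrec fun a => listVal (w a) (n a) :=
  (Primrec.list_getD (0 : ℤ)).comp hw hn

theorem primrec_clockVal {l : α → List ℕ} {n : α → ℕ} (hl : Primrec l) (hn : Primrec n) :
    Primrec fun a => clockVal (l a) (n a) :=
  (Primrec.list_getD (0 : ℕ)).comp hl hn

theorem primrec_trunc {M : α → ℕ} {ω : α → ClockVal} (hM : Primrec M) (hω : Primrec₂ ω) :
    Primrec fun a => trunc (M a) (ω a) :=
  Primrec.list_map (Primrec.list_range.comp hM) hω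

theorem primrec_tickClocks {l : α → List ℕ} (hl : Primrec l) :
    Primrec₂ fun a => tickClocks (clockVal (l a)) :=
  Primrec.succ.comp (primrec_clockVal (hl.comp Primrec.fst) Primrec.snd)

theorem primrec_applyUpdate {l : α → List ℕ} {u : α → UpdateSet} (hl : Primrec l)
    (hu : Primrec u) : Primrec₂ fun a => applyUpdate (clockVal (l a)) (u a) :=
  Primrec.option_getD.comp (Primrec.listLookup.comp Primrec.snd (hu.comp Primrec.fst))
    (primrec_clockVal (hl.comp Primrec.fst) Primrec.snd)

theorem primrec_clockTermEval {l : α → List ℕ} {t : α → ClockTerm} (hl : Primrec l)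
    (ht : Primrec t) : Primrec fun a => (t a).eval (clockVal (l a)) := by
  have hv : ∀ {β : Type _} [Primcodable β] {b : β → α} {n : β → ℕ}, Primrec b → Primrec n →
      Primrec fun p => (clockVal (l (b p)) (n p) : ℤ) := fun hb hn =>
    primrec_intCast.comp (primrec_clockVal (hl.comp hb) hn)
  refine (Primrec.sumCasesOn (primrec_clockTermEquiv.comp ht)
    (g := fun a s => Sum.casesOn s (fun x => (clockVal (l a) x : ℤ))
      (fun x => -(clockVal (l a) x : ℤ)))
    (h := fun a p => (clockVal (l a) p.1 : ℤ) - clockVal (l a) p.2) ?_ ?_).of_eq ?_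
  · exact Primrec.sumCasesOn Primrec.snd
      (hv (Primrec.fst.comp Primrec.fst) Primrec.snd)
      (primrec_intNeg (hv (Primrec.fst.comp Primrec.fst) Primrec.snd))
  · exact primrec_intSub (hv Primrec.fst (Primrec.fst.comp Primrec.snd))
      (hv Primrec.fst (Primrec.snd.comp Primrec.snd))
  · intro a
    cases t a <;> rfl

theorem primrecPred_of_bool {p : α → Prop} {b : α → Bool} (hb : Primrec b)
    (h : ∀ a, b a = true ↔ p a) : PrimrecPred p :=
  (Primrec.eq.comp hb (Primrec.const true)).of_eq h

/-- Comparison of an integer with an integer or `∞` (that is, `none`), as a Boolean. -/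
def cmpBool (c : Comparison) (z : ℤ) (o : Option ℤ) : Bool :=
  match c, o with
  | .lt, some y => decide (z < y)
  | .le, some y => decide (z ≤ y)
  | .eq, some y => decide (z = y)
  | .lt, none => true
  | .le, none => true
  | .eq, none => false

theorem primrec_cmpBool (c : Comparison) {z : α → ℤ} {o : α → Option ℤ} (hz : Primrec z)
    (ho : Primrec o) : Primrec fun a => cmpBool c (z a) (o a) := by
  cases c
  · refine (Primrec.option_casesOn ho (Primrec.const true)
      (g := fun a y => decide (z a < y)) ?_).of_eq fun a => by cases o a <;> rfl
    exact (primrecPred_intLt (hz.comp Primrec.fst) Primrec.snd).decide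
  · refine (Primrec.option_casesOn ho (Primrec.const true)
      (g := fun a y => decide (z a ≤ y)) ?_).of_eq fun a => by cases o a <;> rfl
    exact (primrecPred_intLe (hz.comp Primrec.fst) Primrec.snd).decide
  · refine (Primrec.option_casesOn ho (Primrec.const false)
      (g := fun a y => decide (z a = y)) ?_).of_eq fun a => by cases o a <;> rfl
    exact (Primrec.eq.comp (hz.comp Primrec.fst) Primrec.snd).decide

def Expression.listEval (w : List ℤ) (r : Expression) : Option ℤ :=
  (Expression.equiv r).map fun e => listVal w (encode e)

theorem primrec_listEval {w : α → List ℤ} {r : α → Expression} (hw : Primrec w)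
    (hr : Primrec r) : Primrec fun a => (r a).listEval (w a) :=
  Primrec.option_map (primrec_expressionEquiv.comp hr)
    (primrec_listVal (hw.comp Primrec.fst) (Primrec.encode.comp Primrec.snd))

theorem truth_iff_cmpBool (w : List ℤ) (l : List ℕ) (c : AtomicConstraint) :
    cmpBool c.cmp (c.lhs.eval (clockVal l)) (c.rhs.listEval w) = true ↔ Truth w l c := by
  obtain ⟨t, m, e | _⟩ := c <;> cases m <;>
    simp [cmpBool, Truth, AtomicConstraint.HoldsV, Comparison.Holds, Expression.listEval,
      Expression.equiv]

theorem primrecPred_truth {w : α → List ℤ} {l : α → List ℕ} {c : α → AtomicConstraint}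
    (hw : Primrec w) (hl : Primrec l) (hc : Primrec c) :
    PrimrecPred fun a => Truth (w a) (l a) (c a) := by
  have hcmp : ∀ (m : Comparison) {β : Type _} [Primcodable β] {b : β → α}
      {p : β → ClockTerm × Expression}, Primrec b → Primrec p →
      Primrec fun x => cmpBool m ((p x).1.eval (clockVal (l (b x)))) ((p x).2.listEval (w (b x))) :=
    fun m _ _ _ _ hb hp => primrec_cmpBool m
      (primrec_clockTermEval (hl.comp hb) (Primrec.fst.comp hp))
      (primrec_listEval (hw.comp hb) (Primrec.snd.comp hp))
  refine primrecPred_of_bool (Primrec.sumCasesOn (primrec_constraintEquiv.comp hc)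
    (g := fun a s => Sum.casesOn s
      (fun p => cmpBool .lt (p.1.eval (clockVal (l a))) (p.2.listEval (w a)))
      (fun p => cmpBool .le (p.1.eval (clockVal (l a))) (p.2.listEval (w a))))
    (h := fun a p => cmpBool .eq (p.1.eval (clockVal (l a))) (p.2.listEval (w a))) ?_ ?_) ?_
  · exact Primrec.sumCasesOn Primrec.snd
      (hcmp .lt (Primrec.fst.comp Primrec.fst) Primrec.snd)
      (hcmp .le (Primrec.fst.comp Primrec.fst) Primrec.snd)
  · exact hcmp .eq Primrec.fst Primrec.snd
  · intro a
    rw [← truth_iff_cmpBool]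
    rcases c a with ⟨t, _ | _ | _, r⟩ <;> rfl

theorem primrecPred_forall_truth {w : α → List ℤ} {l : α → List ℕ} {g : α → SimpleConstraint}
    (hw : Primrec w) (hl : Primrec l) (hg : Primrec g) :
    PrimrecPred fun a => ∀ c ∈ g a, Truth (w a) (l a) c := by
  have h : PrimrecRel fun (c : AtomicConstraint) (p : List ℤ × List ℕ) => Truth p.1 p.2 c :=
    primrecPred_truth (Primrec.fst.comp Primrec.snd) (Primrec.snd.comp Primrec.snd) Primrec.fst
  exact (PrimrecRel.forall_mem_list h).comp hg (hw.pair hl)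

open Classical in
theorem primrecPred_invHolds {A : α → PTA} {w : α → List ℤ} {l : α → List ℕ} {q : α → ℕ}
    (hA : Primrec A) (hw : Primrec w) (hl : Primrec l) (hq : Primrec q) :
    PrimrecPred fun a => (A a).InvHolds (Truth (w a) (l a)) (q a) := by
  refine primrecPred_of_bool (Primrec.option_casesOn
    (Primrec.list_getElem?.comp (primrec_inv.comp hA) hq) (Primrec.const false)
    (g := fun a g => decide (∀ c ∈ g, Truth (w a) (l a) c)) ?_) ?_
  · exact (primrecPred_forall_truth (hw.comp Primrec.fst) (hl.comp Primrec.fst)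
      Primrec.snd).decide
  · intro a
    unfold PTA.InvHolds
    cases (A a).inv[q a]? <;> simp

theorem StateProp.ofNat_encode (φ : StateProp) : StateProp.ofNat (encode φ) = φ :=
  StateProp.equiv.left_inv φ

open Classical in
/-- The truth value of the state property with code `L.length`, from those with smaller codes. -/
noncomputable def evalStep (p : List ℤ × ℕ × List ℕ) (L : List Bool) : Bool :=
  if L.length % 5 = 0 then
    decide (Truth p.1 p.2.2 (Denumerable.ofNat AtomicConstraint (L.length / 5)))
  else if L.length % 5 = 1 then decide (p.2.1 = L.length / 5)
  else if L.length % 5 = 2 then !(L.getD (L.length / 5) false)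
  else if L.length % 5 = 3 then
    L.getD (Nat.unpair (L.length / 5)).1 false && L.getD (Nat.unpair (L.length / 5)).2 false
  else L.getD (Nat.unpair (L.length / 5)).1 false || L.getD (Nat.unpair (L.length / 5)).2 false

open Classical in
theorem primrec_evalStep : Primrec₂ evalStep := by
  have hlen : Primrec fun x : (List ℤ × ℕ × List ℕ) × List Bool => x.2.length :=
    Primrec.list_length.comp Primrec.snd
  have hmod : ∀ i, PrimrecPred fun x : (List ℤ × ℕ × List ℕ) × List Bool => x.2.length % 5 = i :=
    fun i => Primrec.eq.comp (Primrec.nat_mod.comp hlen (Primrec.const 5)) (Primrec.const i)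
  have hdiv : Primrec fun x : (List ℤ × ℕ × List ℕ) × List Bool => x.2.length / 5 :=
    Primrec.nat_div.comp hlen (Primrec.const 5)
  have hget : ∀ {n : (List ℤ × ℕ × List ℕ) × List Bool → ℕ}, Primrec n →
      Primrec fun x : (List ℤ × ℕ × List ℕ) × List Bool => x.2.getD (n x) false := fun hn =>
    (Primrec.list_getD false).comp Primrec.snd hn
  have h1 := hget (Primrec.fst.comp (Primrec.unpair.comp hdiv))
  have h2 := hget (Primrec.snd.comp (Primrec.unpair.comp hdiv))
  refine Primrec.ite (hmod 0) ?_ (Primrec.ite (hmod 1) ?_ (Primrec.ite (hmod 2)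
    (Primrec.not.comp (hget hdiv)) (Primrec.ite (hmod 3) (Primrec.and.comp h1 h2)
      (Primrec.or.comp h1 h2))))
  · exact (primrecPred_truth (Primrec.fst.comp Primrec.fst)
      (Primrec.snd.comp (Primrec.snd.comp Primrec.fst)) ((Primrec.ofNat _).comp hdiv)).decide
  · exact (Primrec.eq.comp (Primrec.fst.comp (Primrec.snd.comp Primrec.fst)) hdiv).decide

-- Immediate subformulas have smaller codes, so their values are in the list and the default `false`
-- is never read. This makes evaluation a course-of-values recursion on the code of the property.
open Classical in
theorem evalStep_range (p : List ℤ × ℕ × List ℕ) (n : ℕ) :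
    evalStep p ((List.range n).map fun m => decide ((StateProp.ofNat m).Eval (Truth p.1 p.2.2) p.2.1))
      = decide ((StateProp.ofNat n).Eval (Truth p.1 p.2.2) p.2.1) := by
  have hget : ∀ m < n, ((List.range n).map fun m =>
      decide ((StateProp.ofNat m).Eval (Truth p.1 p.2.2) p.2.1)).getD m false =
      decide ((StateProp.ofNat m).Eval (Truth p.1 p.2.2) p.2.1) := by
    intro m hm
    simp [List.getD, hm]
  have h1 := Nat.unpair_left_le (n / 5)
  have h2 := Nat.unpair_right_le (n / 5)
  rw [StateProp.ofNat, evalStep]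
  simp only [List.length_map, List.length_range]
  split_ifs with c0 c1 c2 c3
  · simp [StateProp.Eval]
  · exact Bool.eq_iff_iff.2 (.trans (by simp [StateProp.Eval]) decide_eq_true_iff.symm)
  · rw [hget _ (by omega)]
    exact Bool.eq_iff_iff.2 (.trans (by simp [StateProp.Eval]) decide_eq_true_iff.symm)
  · rw [hget _ (by omega), hget _ (by omega)]
    exact Bool.eq_iff_iff.2 (.trans (by simp [StateProp.Eval]) decide_eq_true_iff.symm)
  · rw [hget _ (by omega), hget _ (by omega)]
    exact Bool.eq_iff_iff.2 (.trans (by simp [StateProp.Eval]) decide_eq_true_iff.symm)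

open Classical in
theorem primrecPred_eval {w : α → List ℤ} {l : α → List ℕ} {q : α → ℕ} {φ : α → StateProp}
    (hw : Primrec w) (hl : Primrec l) (hq : Primrec q) (hφ : Primrec φ) :
    PrimrecPred fun a => (φ a).Eval (Truth (w a) (l a)) (q a) := by
  have h := Primrec.nat_strong_rec
    (fun (p : List ℤ × ℕ × List ℕ) n =>
      decide ((StateProp.ofNat n).Eval (Truth p.1 p.2.2) p.2.1))
    (g := fun p L => some (evalStep p L)) (Primrec.option_some.comp primrec_evalStep)
    (fun p n => congrArg some (evalStep_range p n))
  refine primrecPred_of_bool (h.comp (hw.pair (hq.pair hl)) (Primrec.encode.comp hφ)) fun a => ?_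
  simp [StateProp.ofNat_encode]

end Semantics

/-! ### Primitive recursiveness of the synthesis -/

section Algorithm

variable {α : Type*} [Primcodable α]

open Classical in
theorem primrec_searchStep {A : α → PTA} {w : α → List ℤ} {M : α → ℕ} {s : α → ℕ × List ℕ}
    (hA : Primrec A) (hw : Primrec w) (hM : Primrec M) (hs : Primrec s) :
    Primrec fun a => searchStep (A a) (w a) (M a) (s a) := by
  have hs2 := Primrec.snd.comp hs
  have ht := primrec_trunc hM (primrec_tickClocks hs2)
  have h2 : ∀ {β : Type _} [Primcodable β] {f : α → β}, Primrec f →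
      Primrec fun p : α × Edge => f p.1 := fun hf => hf.comp Primrec.fst
  have hu : Primrec fun p : α × Edge =>
      trunc (M p.1) (applyUpdate (clockVal (s p.1).2) p.2.upd) :=
    primrec_trunc (h2 hM) (primrec_applyUpdate (h2 hs2) (primrec_upd.comp Primrec.snd))
  have htgt : Primrec fun p : α × Edge => p.2.tgt := primrec_tgt.comp Primrec.snd
  refine Primrec.list_cons.comp hs (Primrec.list_cons.comp ?_
    (Primrec.list_map (primrec_edges.comp hA) ?_))
  · exact Primrec.ite (primrecPred_invHolds hA hw ht (Primrec.fst.comp hs))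
      ((Primrec.fst.comp hs).pair ht) hs
  · refine Primrec.ite (PrimrecPred.and ?_ (PrimrecPred.and ?_ ?_)) (htgt.pair hu) (h2 hs)
    · exact Primrec.eq.comp (primrec_src.comp Primrec.snd) (h2 (Primrec.fst.comp hs))
    · exact primrecPred_forall_truth (h2 hw) (h2 hs2) (primrec_guard.comp Primrec.snd)
    · exact primrecPred_invHolds (h2 hA) (h2 hw) hu htgt

open Classical in
theorem primrec_search {A : α → PTA} {w : α → List ℤ} {M n : α → ℕ}
    (hA : Primrec A) (hw : Primrec w) (hM : Primrec M) (hn : Primrec n) :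
    Primrec fun a => search (A a) (w a) (M a) (n a) := by
  have h0 : Primrec fun a => trunc (M a) fun _ => 0 := primrec_trunc hM (Primrec₂.const 0)
  have hi := primrec_init.comp hA
  refine Primrec.nat_iterate hn ?_ ?_
  · exact Primrec.ite (primrecPred_invHolds hA hw h0 hi)
      (Primrec.list_cons.comp (hi.pair h0) (Primrec.const [])) (Primrec.const [])
  · refine Primrec.list_flatMap Primrec.snd ?_
    have h1 : ∀ {β : Type _} [Primcodable β] {f : α → β}, Primrec f →
        Primrec fun p : (α × List (ℕ × List ℕ)) × (ℕ × List ℕ) => f p.1.1 :=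
      fun hf => hf.comp (Primrec.fst.comp Primrec.fst)
    exact primrec_searchStep (h1 hA) (h1 hw) (h1 hM) Primrec.snd

theorem primrec_box : Primrec₂ box := by
  refine Primrec.nat_iterate (f := fun p : ℕ × ℕ => p.2) Primrec.snd (Primrec.const [[]]) ?_
  refine Primrec.list_flatMap Primrec.snd ?_
  have hB : Primrec fun p : ((ℕ × ℕ) × List (List ℤ)) × List ℤ => p.1.1.1 :=
    Primrec.fst.comp (Primrec.fst.comp Primrec.fst)
  refine Primrec.list_map (Primrec.list_range.comp (Primrec.succ.comp (Primrec.nat_double.comp hB))) ?_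
  exact Primrec.list_cons.comp
    (primrec_natSub.comp Primrec.snd (hB.comp Primrec.fst)) (Primrec.snd.comp Primrec.fst)

theorem primrec_addConst {e : α → LinExpr} {d : α → ℤ} (he : Primrec e) (hd : Primrec d) :
    Primrec fun a => (e a).addConst (d a) :=
  primrec_linExprMk.comp ((primrec_intAdd (primrec_const.comp he) hd).pair (primrec_terms.comp he))

theorem primrec_comb (s : ℤ) {e f : α → LinExpr} (he : Primrec e) (hf : Primrec f) :
    Primrec fun a => (e a).comb s (f a) := by
  refine primrec_linExprMk.comp ((primrec_intAdd (primrec_const.comp he)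
    (primrec_intMul (Primrec.const s) (primrec_const.comp hf))).pair
    (Primrec.list_append.comp (primrec_terms.comp he)
      (Primrec.list_map (primrec_terms.comp hf) ?_)))
  exact (Primrec.fst.comp Primrec.snd).pair
    (primrec_intMul (Primrec.const s) (Primrec.snd.comp Primrec.snd))

theorem primrec_clampCondition {N d : α → ℤ} {e : α → LinExpr} (hN : Primrec N) (hd : Primrec d)
    (he : Primrec e) : Primrec fun a => clampCondition (N a) (d a) (e a) :=
  Primrec.ite (primrecPred_intLe hN hd)
    (primrec_nonneg.comp (primrec_addConst he (primrec_intNeg hN)))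
    (Primrec.ite (primrecPred_intLe hd (primrec_intNeg hN))
      (primrec_nonneg.comp (primrec_comb (-1)
        (primrec_linExprMk.comp ((primrec_intNeg hN).pair (Primrec.const []))) he))
      (primrec_zero.comp (primrec_addConst he (primrec_intNeg hd))))

theorem primrec_similarSystem {K N k : α → ℕ} {w : α → List ℤ} (hK : Primrec K) (hN : Primrec N)
    (hk : Primrec k) (hw : Primrec w) :
    Primrec fun a => similarSystem (K a) (N a) (k a) (w a) := by
  refine Primrec.list_flatMap (Primrec.list_range.comp hK) (Primrec.list_cons.comp ?_ ?_)
  · exact primrec_cong.comp (hk.comp Primrec.fst)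
      (primrec_addConst ((Primrec.ofNat _).comp Primrec.snd)
        (primrec_intNeg (primrec_listVal (hw.comp Primrec.fst) Primrec.snd)))
  · refine Primrec.list_flatMap (Primrec.list_range.comp (hK.comp Primrec.fst)) ?_
    have h1 : ∀ {β : Type _} [Primcodable β] {f : α → β}, Primrec f →
        Primrec fun p : (α × ℕ) × ℕ => f p.1.1 :=
      fun hf => hf.comp (Primrec.fst.comp Primrec.fst)
    have hi : Primrec fun p : (α × ℕ) × ℕ => p.1.2 := Primrec.snd.comp Primrec.fst
    have hei : Primrec fun p : (α × ℕ) × ℕ => Denumerable.ofNat LinExpr p.1.2 :=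
      (Primrec.ofNat _).comp hi
    have hej : Primrec fun p : (α × ℕ) × ℕ => Denumerable.ofNat LinExpr p.2 :=
      (Primrec.ofNat _).comp Primrec.snd
    have hN' := primrec_intCast.comp (h1 hN)
    have hwi := primrec_listVal (h1 hw) hi
    have hwj := primrec_listVal (h1 hw) Primrec.snd
    exact Primrec.list_cons.comp (primrec_clampCondition hN' hwi hei)
      (Primrec.list_cons.comp (primrec_clampCondition hN'
          (primrec_intAdd hwi (primrec_intMul (Primrec.const _) hwj)) (primrec_comb _ hei hej))
        (Primrec.list_cons.comp (primrec_clampCondition hN'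
          (primrec_intAdd hwi (primrec_intMul (Primrec.const _) hwj)) (primrec_comb _ hei hej))
          (Primrec.const [])))

theorem primrec_pow {f g : α → ℕ} (hf : Primrec f) (hg : Primrec g) :
    Primrec fun a => f a ^ g a :=
  (Primrec₂.unpaired'.1 Nat.Primrec.pow).comp hf hg

theorem primrec_factorial : Primrec Nat.factorial := by
  refine (Primrec.nat_rec₁ (f := fun n r => (n + 1) * r) 1
    (Primrec.nat_mul.comp (Primrec.succ.comp Primrec.fst) Primrec.snd)).of_eq fun n => ?_
  induction n with
  | zero => rfl
  | succ n ih => rw [Nat.factorial_succ, ← ih]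

theorem primrec_setBound : Primrec setBound := by
  have h : Primrec fun M => (2 * M + 1) ^ M := primrec_pow Primrec.nat_double_succ Primrec.id
  exact primrec_pow (Primrec.const 2) (Primrec.nat_mul.comp Primrec.succ
    (Primrec.nat_mul.comp h (primrec_pow h Primrec.id)))

theorem primrec_period : Primrec period := primrec_factorial.comp primrec_setBound

theorem primrec_threshold : Primrec threshold :=
  Primrec.nat_add.comp (Primrec.nat_add.comp
    (Primrec.nat_add.comp primrec_setBound primrec_period) Primrec.id) (Primrec.const 2)

theorem primrec_entryBound : Primrec entryBound :=
  Primrec.nat_mul.comp (Primrec.nat_add.comp primrec_threshold primrec_period) Primrec.succ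

theorem primrec_clockBound : Primrec clockBound :=
  Primrec.succ.comp (Primrec.nat_add.comp Primrec.id primrec_entryBound)

open Classical in
theorem primrec_synthBounded {A : α → PTA} {φ : α → StateProp} {K : α → ℕ} (hA : Primrec A)
    (hφ : Primrec φ) (hK : Primrec K) : Primrec fun a => synthBounded (A a) (φ a) (K a) := by
  refine Primrec.list_flatMap (primrec_box.comp (primrec_entryBound.comp hK) hK) ?_
  have hM := primrec_clockBound.comp hK
  refine Primrec.ite ?_ (Primrec.const []) (Primrec.list_cons.comp ?_ (Primrec.const []))
  · have hR : PrimrecRel fun (s : ℕ × List ℕ) (p : StateProp × List ℤ) =>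
        ¬ p.1.Eval (Truth p.2 s.2) s.1 :=
      (primrecPred_eval (Primrec.snd.comp Primrec.snd) (Primrec.snd.comp Primrec.fst)
        (Primrec.fst.comp Primrec.fst) (Primrec.fst.comp Primrec.snd)).not
    exact (PrimrecRel.exists_mem_list hR).comp
      (primrec_search (hA.comp Primrec.fst) Primrec.snd (hM.comp Primrec.fst)
        ((primrec_setBound.comp hM).comp Primrec.fst)) ((hφ.comp Primrec.fst).pair Primrec.snd)
  · exact primrec_similarSystem (hK.comp Primrec.fst) ((primrec_threshold.comp hK).comp Primrec.fst)
      ((primrec_period.comp hK).comp Primrec.fst) Primrec.snd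

end Algorithm

end ParamTA

theorem mainTheorem4 :
    ∃ synth : ParamTA.PTA × ParamTA.StateProp → List ParamTA.ParamSystem,
      Computable synth ∧
        ∀ (A : ParamTA.PTA) (φ : ParamTA.StateProp),
          A.WellFormed → ParamTA.OneParametricClock A φ →
            ParamTA.solutionSet (synth (A, φ)) = A.feasible (ParamTA.SystemProp.always φ) := by
  -- The algorithm needs neither the parametric clock nor a test for it; the clock `x` occurs only
  -- in the correctness proof.
  refine ⟨fun p => ParamTA.synthBounded p.1 p.2 (Encodable.encode p + 1), ?_, ?_⟩
  · exact (ParamTA.primrec_synthBounded Primrec.fst Primrec.snd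
      (Primrec.succ.comp Primrec.encode)).to_comp
  · rintro A φ - ⟨x, hx⟩
    exact ParamTA.solutionSet_synthBounded (ParamTA.boundedBy_encode A φ) hx
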